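/- **Setting.** Let $G$ be a group, $K\le G$ a subgroup and $X\subseteq G$ such that $K$ is hyperbolically embedded in $G$ with respect to $X$. This means: $X\cup K$ generates $G$; the Cayley graph $\Gamma=\Gamma(G,X\sqcup K)$ is hyperbolic; and $K$ is locally finite for the relative metric $\hat d$, where $\hat d(u,v)\in\{0,1,\dots,\infty\}$ is the least length of a path in $\Gamma$ from $u$ to $v$ containing no $K$-labelled edge between points of $K$ (that is, all balls of finite radius are finite). **The extension.** Fix an integer $C$ and a representative $a$ of each left coset $aK$. For $x,y\in G$ let $S(x,y)$ be the set of cosets $aK$ such that some geodesic of $\Gamma$ from $x$ to $y$ enters $aK$ at a point $au$ and exits it at a point $av$ with $\hat d(u,v)\ge C$. For $aK\in S(x,y)$ let $E(x,y;aK)\subseteq K\times K$ be the set of all pairs $(u,v)$ such that $au$ and $av$ are the entry and exit points in $aK$ of some geodesic from $x$ to $y$. The Hull–Osin extension of a function $H:K\to\mathbb R$ is $$\tilde H(g)=\sum_{aK\in S(1,g)}\frac1{|E(1,g;aK)|}\sum_{(u,v)\in E(1,g;aK)}H(u^{-1}v),\qquad g\in G.$$ **The quasimorphisms.** Suppose $K\cong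 F\times N$, where $F$ is a free group of rank at least two and $N$ is a finite group, and let $a\ne b$ be two elements of a basis of $F$. For $w,x\in F$ let $N_w(x)$ be the number of occurrences of the reduced word $w$ as a subword of the reduced word representing $x$, and let $H_w=N_w-N_{w^{-1}}$. For $i\ge1$ let $g_i=ab^{2i}ab^{2i+1}$, let $H_i(f,n)=H_{g_i}(f)$ for $(f,n)\in F\times N=K$, and let $\tilde H_i:G\to\mathbb R$ be the Hull–Osin extension of $H_i$. **Proposition 4.2.** There is a $C_0$, depending only on $G$, $K$ and $X$, such that for every integer $C\ge C_0$ all the sets $S(x,y)$ and $E(x,y;aK)$ are finite (so that all the sums above are finite), and, for every identification $K\cong F\times N$ and every choice of $a\neq b$ as above, there is an integer $M>0$ such that: 1. for all $x,y\in G$, the equality $\tilde H_i(xy)-\tilde H_i(x)-\tilde H_i(y)=0$ holds for all but at most $M$ indices $i\ge1$; 2. for all $k\ge1$ and $a_1,\dots,a_k\in G$, the equality $\tilde H_i(a_1\cdots a_k)-\tilde H_i(a_1)-\dots-\tilde H_i(a_k)=0$ holds for all but at most $M(k-1)$ indices $i\ge1$. -/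

import Mathlib

namespace HullOsin

section HypEmb

variable {G : Type*} [Group G]

/-- The Cayley graph `Γ(G, X ⊔ K)`.  As a simple graph it forgets loops, labels and multiple edges,
none of which affects lengths of shortest paths. -/
def cayley (X : Set G) (K : Subgroup G) : SimpleGraph G :=
  SimpleGraph.mulCayley (X ∪ (K : Set G))

/-- `Γ(G, X ⊔ K)` with the edges labelled by `K` between points of `K` removed.  The edges labelled
by `X`, and the edges labelled by `K` inside the other cosets of `K`, are kept. -/
def cayleyOutside (X : Set G) (K : Subgroup G) : SimpleGraph G :=
  SimpleGraph.mulCayley X ⊔ SimpleGraph.fromRel (fun u v => u⁻¹ * v ∈ K ∧ u ∉ K)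

/-- The relative metric on `K`: the least length of a path in `Γ(G, X ⊔ K)` that connects
`u` to `v` and contains no edge labelled by `K` between points of `K`; it is `⊤` if there is no such
path. -/
noncomputable def relDist (X : Set G) (K : Subgroup G) (u v : K) : ℕ∞ :=
  (cayleyOutside X K).edist (u : G) (v : G)

/-- A walk in a graph is geodesic if no walk with the same ends is shorter. -/
def IsGeodesic {V : Type*} {Γ : SimpleGraph V} {x y : V} (p : Γ.Walk x y) : Prop :=
  p.length = Γ.dist x y

/-- Hyperbolicity of a connected graph: geodesic triangles are uniformly slim. -/
def IsHyperbolicGraph {V : Type*} (Γ : SimpleGraph V) : Prop :=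
  Γ.Connected ∧ ∃ δ : ℕ, ∀ (x y z : V) (p : Γ.Walk x y) (q : Γ.Walk y z) (r : Γ.Walk x z),
    IsGeodesic p → IsGeodesic q → IsGeodesic r →
      ∀ v ∈ p.support, ∃ w, (w ∈ q.support ∨ w ∈ r.support) ∧ Γ.dist v w ≤ δ

/-- `K` is hyperbolically embedded in `G` with respect to the relative generating set `X`. -/
structure IsHypEmbedded (X : Set G) (K : Subgroup G) : Prop where
  generates : Subgroup.closure (X ∪ (K : Set G)) = ⊤
  hyperbolic : IsHyperbolicGraph (cayley X K)
  locally_finite : ∀ (u : K) (n : ℕ), {v : K | relDist X K u v ≤ n}.Finite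

/-- The walk `p` meets the set `A`, and `u`, `v` are the first and the last vertex of `p` in `A`:
the entry point and the exit point. -/
def EntersExits {V : Type*} {Γ : SimpleGraph V} {x y : V} (p : Γ.Walk x y) (A : Set V)
    (u v : V) : Prop :=
  u ∈ A ∧ v ∈ A ∧
    (∃ i ≤ p.length, p.getVert i = u ∧ ∀ j < i, p.getVert j ∉ A) ∧
    (∃ i ≤ p.length, p.getVert i = v ∧ ∀ j, i < j → j ≤ p.length → p.getVert j ∉ A)

/-- The left coset `c` as a set of elements of `G`. -/
def cosetSet {K : Subgroup G} (c : G ⧸ K) : Set G := {g | (g : G ⧸ K) = c}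

/-- The set of pairs `(u, v)` in `K × K` such that `a u` and `a v` are the entry point and the
exit point in the coset `c = aK` of some geodesic from `x` to `y`.  The representative `a = c.out`
is fixed once and for all. -/
def geodPairs (X : Set G) (K : Subgroup G) (x y : G) (c : G ⧸ K) : Set (K × K) :=
  {t | ∃ p : (cayley X K).Walk x y, IsGeodesic p ∧
    EntersExits p (cosetSet c) (c.out * (t.1 : G)) (c.out * (t.2 : G))}

/-- `S(x, y)`: the cosets that some geodesic from `x` to `y` essentially penetrates, i.e. for which
every path from the entry point to the exit point without `K`-edges of that coset has
length at least `C`. -/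
def sepCosets (X : Set G) (K : Subgroup G) (C : ℕ) (x y : G) : Set (G ⧸ K) :=
  {c | ∃ t ∈ geodPairs X K x y c, (C : ℕ∞) ≤ relDist X K t.1 t.2}

/-- `E(x, y; c)`: all pairs of entry and exit points if `c ∈ S(x, y)`, and empty otherwise. -/
def sepPairs (X : Set G) (K : Subgroup G) (C : ℕ) (x y : G) (c : G ⧸ K) : Set (K × K) :=
  {t | c ∈ sepCosets X K C x y ∧ t ∈ geodPairs X K x y c}

/-- The bicombing of a function on a group. -/
def bicombing {K : Type*} [Group K] (H : K → ℝ) (u v : K) : ℝ := H (u⁻¹ * v)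

/-- The extended bicombing: the sum over `c ∈ S(x, y)` of the average over `E(x, y; c)` of the
bicombing of `H`. -/
noncomputable def extBicombing (X : Set G) (K : Subgroup G) (C : ℕ) (H : K → ℝ) (x y : G) : ℝ :=
  ∑ᶠ c ∈ sepCosets X K C x y,
    (1 / ((sepPairs X K C x y c).ncard : ℝ)) *
      ∑ᶠ t ∈ sepPairs X K C x y c, bicombing H t.1 t.2

/-- The Hull–Osin extension of `H : K → ℝ` to `G`. -/
noncomputable def extension (X : Set G) (K : Subgroup G) (C : ℕ) (H : K → ℝ) (g : G) : ℝ :=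
  extBicombing X K C H 1 g

end HypEmb

section Brooks

variable {α : Type*} [DecidableEq α]

/-- The number of occurrences (overlaps allowed) of the reduced word of `w` as a subword of the
reduced word of `x`. -/
def occurrences (w x : FreeGroup α) : ℕ :=
  x.toWord.tails.countP (fun t => w.toWord.isPrefixOf t)

/-- The Brooks counting quasi-morphism of `w`. -/
def brooks (w x : FreeGroup α) : ℤ := (occurrences w x : ℤ) - occurrences w⁻¹ x

/-- The word `a b^(2i) a b^(2i+1)` in the basis elements `a`, `b`. -/
def gWord (a b : α) (i : ℕ) : FreeGroup α :=
  FreeGroup.of a * FreeGroup.of b ^ (2 * i) * (FreeGroup.of a * FreeGroup.of b ^ (2 * i + 1))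

/-- The Brooks quasi-morphism of the `i`-th word, on a group `K` identified with `F × N` and
constant in the second factor. -/
def brooksOn {K N : Type*} [Group K] [Group N] (e : FreeGroup α × N ≃* K) (a b : α) (i : ℕ)
    (k : K) : ℝ :=
  (brooks (gWord a b i) (e.symm k).1 : ℝ)

end Brooks

end HullOsin

/-! The argument combines a count in free groups with the geometry of nearest-point projections to
cosets.

In the free group, a copy of `g_i` or of its inverse that straddles the junction of two given words
can be read off from the runs of `b` next to the junction, so this happens for at most four `i`.
Write `f = pq`, `g = q⁻¹r`, `fg = pr` without cancellation. As the counting functions are odd, the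
`q` terms cancel, and `H_i` is additive on `(f, g)` for all but 12 indices
(`encard_brooks_mul_ne_le`).

In the Cayley graph every coset `aK` is a clique. By slimness, if the projections of `x` and `y` to
it are far apart for the relative metric, every geodesic from `x` to `y` uses an edge of it
(`IsSlim.penetrates`). The entry-exit pairs then form the full product of the two projections
(`mem_geodPairs_iff`). Local finiteness bounds the size of projections, and each coset contributes
an average over a product, cut off at `C`.

For the triangle `1, x, xy`, at any coset where two of the three projections agree, the
contributions cancel exactly. If all three differ and some contribution survives the cutoff, the
coset is the last one shared by two sides before they branch (`subsingleton_setOf_proj_ne`), so at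
most three cosets matter. For large `i` the function `H_i` vanishes on the relative ball of radius
`C`, so the cutoff is invisible there. It remains to have additivity on boundedly many triples of
projection points, each of which excludes at most 12 indices. The statement for `k` factors follows
by induction. -/

namespace HullOsin

/-! ### Counting subwords; words straddling a junction. -/

section WordCount

variable {β γ : Type*}

section Count

variable [DecidableEq β] [DecidableEq γ]

/-- The number of occurrences of the list `w` as a contiguous sublist of `l`. -/
def countInfix (w l : List β) : ℕ := l.tails.countP (fun t => w.isPrefixOf t)

theorem countInfix_nil {w : List β} (hw : w ≠ []) : countInfix w [] = 0 := by
  cases w <;> simp_all [countInfix]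

theorem countInfix_cons (w : List β) (a : β) (l : List β) :
    countInfix w (a :: l) = countInfix w l + if w <+: a :: l then 1 else 0 := by
  simp [countInfix, List.countP_cons]

/-- The count is defined by prefixes of tails; this version, by suffixes, gives invariance under
reversal. -/
theorem countInfix_concat {w : List β} (hw : w ≠ []) (l : List β) (a : β) :
    countInfix w (l ++ [a]) = countInfix w l + if w <:+ l ++ [a] then 1 else 0 := by
  induction l with
  | nil =>
    have : w <+: [a] ↔ w <:+ [a] := by
      rw [← List.nil_append [a], List.prefix_concat_iff, List.nil_append, List.suffix_cons_iff]
      simp [hw]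
    simp [countInfix_cons, countInfix_nil hw, this]
  | cons b l ih =>
    have hlen : w <+: b :: l → w ≠ b :: (l ++ [a]) := by
      rintro h rfl; simpa using h.length_le
    have hlen' : w <:+ l ++ [a] → w ≠ b :: (l ++ [a]) := by
      rintro h rfl; simpa using h.length_le
    have h1 : w <+: b :: (l ++ [a]) ↔ w = b :: (l ++ [a]) ∨ w <+: b :: l := by
      rw [← List.cons_append, List.prefix_concat_iff]
    simp only [List.cons_append, countInfix_cons, ih, List.suffix_cons_iff, h1]
    by_cases h2 : w = b :: (l ++ [a])
    · have h3 := mt hlen (not_not.2 h2)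
      have h4 := mt hlen' (not_not.2 h2)
      rw [if_neg h3, if_neg h4, if_pos (Or.inl h2), if_pos (Or.inl h2)]
    · simp only [h2, false_or]; omega

theorem countInfix_reverse {w : List β} (hw : w ≠ []) (l : List β) :
    countInfix w.reverse l.reverse = countInfix w l := by
  induction l with
  | nil => simp [countInfix_nil, hw]
  | cons a l ih =>
    rw [List.reverse_cons, countInfix_concat (by simpa using hw), ih, countInfix_cons,
      ← List.reverse_cons]
    simp only [List.reverse_suffix]

theorem countInfix_map {f : β → γ} (hf : Function.Injective f) (w l : List β) :
    countInfix (w.map f) (l.map f) = countInfix w l := by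
  induction l with
  | nil => cases w <;> simp [countInfix]
  | cons a l ih =>
    rw [List.map_cons, countInfix_cons, ih, countInfix_cons, ← List.map_cons]
    simp only [List.prefix_map_iff_of_injective hf]

theorem countInfix_eq_zero_of_length_lt {w l : List β} (h : l.length < w.length) :
    countInfix w l = 0 := by
  induction l with
  | nil => exact countInfix_nil (by rintro rfl; simp at h)
  | cons a l ih =>
    have : ¬ w <+: a :: l := fun h' => by have := h'.length_le; omega
    rw [countInfix_cons, ih (by simp at h; omega), if_neg this]

end Count

/-- The word `w` can occur across the junction of `l₁` and `l₂`. -/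
def Straddles (w l₁ l₂ : List β) : Prop :=
  ∃ s t, s ≠ [] ∧ t ≠ [] ∧ w = s ++ t ∧ s <:+ l₁ ∧ t <+: l₂

theorem Straddles.reverse {w l₁ l₂ : List β} (h : Straddles w l₁ l₂) :
    Straddles w.reverse l₂.reverse l₁.reverse := by
  obtain ⟨s, t, hs, ht, rfl, h1, h2⟩ := h
  exact ⟨t.reverse, s.reverse, by simpa, by simpa, by simp, by simpa, by simpa⟩

theorem countInfix_append [DecidableEq β] {w l₁ l₂ : List β} (hw : w ≠ []) (h : ¬ Straddles w l₁ l₂) :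
    countInfix w (l₁ ++ l₂) = countInfix w l₁ + countInfix w l₂ := by
  induction l₁ with
  | nil => simp [countInfix_nil hw]
  | cons a l₁ ih =>
    have h' : ¬ Straddles w l₁ l₂ := by
      rintro ⟨s, t, hs, ht, e, h1, h2⟩
      exact h ⟨s, t, hs, ht, e, h1.trans (List.suffix_cons _ _), h2⟩
    have key : w <+: a :: l₁ ++ l₂ ↔ w <+: a :: l₁ := by
      refine ⟨fun ⟨r, hr⟩ => ?_, fun h => h.trans (List.prefix_append _ _)⟩
      rcases List.append_eq_append_iff.1 hr with ⟨t, e1, e2⟩ | ⟨t, e1, e2⟩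
      · exact ⟨t, e1.symm⟩
      · by_cases ht : t = []
        · subst ht; simp [e1]
        · exact (h ⟨a :: l₁, t, by simp, ht, e1, List.suffix_rfl, ⟨r, e2.symm⟩⟩).elim
    rw [List.cons_append, countInfix_cons, ih h', countInfix_cons, ← List.cons_append]
    simp only [key]
    omega

/-- The word `A B^(2i) A B^(2i+1)` in letters `A`, `B`. -/
def abWord (A B : β) (i : ℕ) : List β :=
  A :: (List.replicate (2 * i) B ++ A :: List.replicate (2 * i + 1) B)

theorem abWord_ne_nil (A B : β) (i : ℕ) : abWord A B i ≠ [] := by simp [abWord]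

/-- Both exponents are the position of the first letter of `L` other than `B`. -/
theorem eq_of_replicate_cons_prefix {A B : β} (hAB : A ≠ B) {m n : ℕ} {r s L : List β}
    (h1 : List.replicate m B ++ A :: r <+: L) (h2 : List.replicate n B ++ A :: s <+: L) :
    m = n := by
  induction m generalizing n L with
  | zero =>
    cases n with
    | zero => rfl
    | succ n =>
      obtain ⟨t, rfl⟩ := h1
      simp [List.replicate_succ, hAB.symm] at h2
  | succ m ih =>
    cases n with
    | zero =>
      obtain ⟨t, rfl⟩ := h2
      simp [List.replicate_succ, hAB.symm] at h1
    | succ n =>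
      cases L with
      | nil => simp [List.replicate_succ] at h1
      | cons x L =>
        simp only [List.replicate_succ, List.cons_append, List.cons_prefix_cons] at h1 h2
        rw [ih h1.2 h2.2]

theorem replicate_append_cons_eq {A B : β} {m : ℕ} {r s t : List β}
    (h : s ++ t = List.replicate m B ++ A :: r) :
    (∃ j k, j + k = m ∧ s = List.replicate j B ∧ t = List.replicate k B ++ A :: r) ∨
      ∃ s', s = List.replicate m B ++ A :: s' ∧ s' ++ t = r := by
  rcases List.append_eq_append_iff.1 h with ⟨u, e1, e2⟩ | ⟨u, e1, e2⟩
  · left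
    obtain ⟨h0, h1, h2⟩ := List.append_eq_replicate_iff.1 e1.symm
    exact ⟨s.length, u.length, h0, h1, by rw [e2, h2]; simp⟩
  · cases u with
    | nil => exact Or.inl ⟨m, 0, by simp, by simpa using e1, by simpa using e2.symm⟩
    | cons a u =>
      simp only [List.cons_append, List.cons.injEq] at e2
      exact Or.inr ⟨u, by rw [e1, e2.1], e2.2.symm⟩

/-- Cut the word at the junction. If the second `A` falls in `l₂`, then `2 * i` is the run of `B`
ending `l₁` plus the run starting `l₂` (`S₁`). If it falls in `l₁`, then `2 * i` is the run between
the last two letters `A` of `l₁` (`S₂`). Each case leaves at most one `i`. -/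
theorem encard_straddles_abWord_le {A B : β} (hAB : A ≠ B) (l₁ l₂ : List β) :
    {i : ℕ | Straddles (abWord A B i) l₁ l₂}.encard ≤ 2 := by
  set S₁ : Set ℕ := {i | ∃ j k r, j + k = 2 * i ∧ A :: List.replicate j B <:+ l₁ ∧
    List.replicate k B ++ A :: r <+: l₂} with hS₁
  set S₂ : Set ℕ := {i | ∃ j, A :: (List.replicate (2 * i) B ++ A :: List.replicate j B) <:+ l₁}
    with hS₂
  have suff {j : ℕ} {s : List β} (h : s ++ A :: List.replicate j B <:+ l₁) :
      List.replicate j B ++ A :: s.reverse <+: l₁.reverse := by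
    rw [← List.reverse_prefix] at h
    simpa using h
  have h₁ : S₁.encard ≤ 1 := by
    refine Set.encard_le_one_iff.2 ?_
    rintro i i' ⟨j, k, r, hi, h1, h2⟩ ⟨j', k', r', hi', h1', h2'⟩
    have e1 := eq_of_replicate_cons_prefix hAB (suff (s := []) h1) (suff (s := []) h1')
    have e2 := eq_of_replicate_cons_prefix hAB h2 h2'
    omega
  have h₂ : S₂.encard ≤ 1 := by
    refine Set.encard_le_one_iff.2 ?_
    rintro i i' ⟨j, h⟩ ⟨j', h'⟩
    rw [← List.cons_append] at h h'
    replace h := suff h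
    replace h' := suff h'
    obtain rfl := eq_of_replicate_cons_prefix hAB h h'
    obtain ⟨t, ht⟩ := h
    rw [← ht, List.append_assoc, List.prefix_append_right_inj] at h'
    simp only [List.reverse_cons, List.reverse_replicate, List.cons_append, List.append_assoc,
      List.nil_append, List.cons_prefix_cons, true_and] at h'
    have := eq_of_replicate_cons_prefix hAB h' (List.prefix_refl _)
    omega
  have hsub : {i : ℕ | Straddles (abWord A B i) l₁ l₂} ⊆ S₁ ∪ S₂ := by
    rintro i ⟨s, t, hs, ht, e, h1, h2⟩
    cases s with
    | nil => exact absurd rfl hs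
    | cons x s =>
      simp only [abWord, List.cons_append, List.cons.injEq] at e
      obtain ⟨rfl, e⟩ := e
      rcases replicate_append_cons_eq e.symm with ⟨j, k, h0, rfl, rfl⟩ | ⟨s', rfl, h0⟩
      · exact Or.inl ⟨j, k, _, h0, h1, h2⟩
      · obtain ⟨-, h3, -⟩ := List.append_eq_replicate_iff.1 h0
        exact Or.inr ⟨s'.length, by rw [← h3]; exact h1⟩
  calc _ ≤ (S₁ ∪ S₂).encard := Set.encard_le_encard hsub
    _ ≤ S₁.encard + S₂.encard := Set.encard_union_le _ _
    _ ≤ 1 + 1 := add_le_add h₁ h₂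
    _ = 2 := by norm_num

end WordCount

/-! ### Brooks quasimorphisms of the words `g_i`. -/

section FreeGroupWords

variable {α : Type*} [DecidableEq α]

theorem occurrences_eq_countInfix (w x : FreeGroup α) :
    occurrences w x = countInfix w.toWord x.toWord :=
  List.countP_congr fun t _ => by simp only [List.isPrefixOf_iff_prefix]

theorem occurrences_inv_inv {w : FreeGroup α} (hw : w ≠ 1) (x : FreeGroup α) :
    occurrences w⁻¹ x⁻¹ = occurrences w x := by
  simp only [occurrences_eq_countInfix]
  have hw' : w.toWord ≠ [] := by simpa using hw
  have hinj : Function.Injective (fun g : α × Bool => (g.1, !g.2)) := by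
    rintro ⟨a, b⟩ ⟨a', b'⟩ h
    simpa using h
  rw [FreeGroup.toWord_inv, FreeGroup.toWord_inv, FreeGroup.invRev, FreeGroup.invRev,
    countInfix_reverse (by simpa using hw), countInfix_map hinj]

theorem brooks_inv {w : FreeGroup α} (hw : w ≠ 1) (x : FreeGroup α) :
    brooks w x⁻¹ = - brooks w x := by
  have h1 := occurrences_inv_inv hw x
  have h2 := occurrences_inv_inv (inv_ne_one.2 hw) x
  rw [inv_inv] at h2
  simp only [brooks, h1, h2]
  ring

/-- Cancel at the junction one letter at a time: if the concatenation is not reduced, the last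
letter of `L₁` is inverse to the first of `L₂`. -/
theorem exists_reduced_append {L₁ : List (α × Bool)} :
    ∀ {L₂ : List (α × Bool)}, FreeGroup.IsReduced L₁ → FreeGroup.IsReduced L₂ →
    ∃ p q r, L₁ = p ++ q ∧ L₂ = FreeGroup.invRev q ++ r ∧ FreeGroup.IsReduced (p ++ r) := by
  induction L₁ using List.reverseRecOn with
  | nil => exact fun {L₂} _ h2 => ⟨[], [], L₂, rfl, rfl, h2⟩
  | append_singleton L x ih =>
    intro L₂ h1 h2
    by_cases h : FreeGroup.IsReduced (L ++ [x] ++ L₂)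
    · exact ⟨L ++ [x], [], L₂, by simp, by simp, h⟩
    · cases L₂ with
      | nil => simp [h1] at h
      | cons y L₂ =>
        have hy : y = (x.1, !x.2) := by
          by_contra hne
          apply h
          have h3 : FreeGroup.IsReduced ([x] ++ y :: L₂) := by
            refine FreeGroup.isReduced_cons_cons.2 ⟨fun e => ?_, h2⟩
            by_contra hb
            exact hne (Prod.ext e.symm (by revert hb; cases x.2 <;> cases y.2 <;> simp))
          exact FreeGroup.IsReduced.append_overlap h1 h3 (by simp)
        obtain ⟨p, q, r, rfl, rfl, hr⟩ := ih (h1.infix ⟨[], [x], by simp⟩)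
          (h2.infix (L₁ := L₂) ⟨[y], [], by simp⟩)
        exact ⟨p, q ++ [x], r, by simp, by simp [hy, FreeGroup.invRev], hr⟩

/-- Two elements of a free group decompose without cancellation so that their product does too. -/
theorem exists_toWord_tripod (f g : FreeGroup α) : ∃ p q r : FreeGroup α,
    f.toWord = p.toWord ++ q.toWord ∧ g.toWord = q⁻¹.toWord ++ r.toWord ∧
      (f * g).toWord = p.toWord ++ r.toWord := by
  obtain ⟨p, q, r, h1, h2, h3⟩ := exists_reduced_append (FreeGroup.isReduced_toWord (x := f))
    (FreeGroup.isReduced_toWord (x := g))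
  have hf := FreeGroup.isReduced_toWord (x := f)
  have hg := FreeGroup.isReduced_toWord (x := g)
  rw [h1] at hf
  rw [h2] at hg
  have ep : (FreeGroup.mk p).toWord = p := by
    rw [FreeGroup.toWord_mk, (hf.infix ⟨[], q, by simp⟩).reduce_eq]
  have eq : (FreeGroup.mk q).toWord = q := by
    rw [FreeGroup.toWord_mk, (hf.infix ⟨p, [], by simp⟩).reduce_eq]
  have er : (FreeGroup.mk r).toWord = r := by
    rw [FreeGroup.toWord_mk, (hg.infix (L₁ := r) ⟨FreeGroup.invRev q, [], by simp⟩).reduce_eq]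
  refine ⟨FreeGroup.mk p, FreeGroup.mk q, FreeGroup.mk r, ?_, ?_, ?_⟩
  · rw [ep, eq, h1]
  · rw [FreeGroup.toWord_inv, eq, er, h2]
  · have : f * g = FreeGroup.mk (p ++ r) := by
      rw [← FreeGroup.mk_toWord (x := f), ← FreeGroup.mk_toWord (x := g), h1, h2,
        ← FreeGroup.mul_mk, ← FreeGroup.mul_mk, ← FreeGroup.mul_mk, ← FreeGroup.inv_mk]
      group
    rw [this, FreeGroup.toWord_mk, h3.reduce_eq, ep, er]

theorem toWord_gWord (a b : α) (i : ℕ) :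
    (gWord a b i).toWord = abWord (a, true) (b, true) i := by
  have : gWord a b i = FreeGroup.mk (abWord (a, true) (b, true) i) := by
    simp only [gWord, FreeGroup.of, abWord]
    simp
  rw [this, FreeGroup.toWord_mk]
  apply FreeGroup.IsReduced.reduce_eq
  have h2 : ∀ t ∈ abWord (a, true) (b, true) i, t.2 = true := by
    intro t ht
    simp only [abWord, List.mem_cons, List.mem_append, List.mem_replicate] at ht
    rcases ht with rfl | ⟨-, rfl⟩ | rfl | ⟨-, rfl⟩ <;> rfl
  have h3 : (abWord (a, true) (b, true) i).Pairwise fun s t => s.1 = t.1 → s.2 = t.2 :=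
    List.pairwise_of_forall_mem_list fun s hs t ht _ => (h2 s hs).trans (h2 t ht).symm
  exact h3.isChain

theorem gWord_ne_one (a b : α) (i : ℕ) : gWord a b i ≠ 1 := by
  rw [ne_eq, ← FreeGroup.toWord_eq_nil_iff, toWord_gWord]
  exact abWord_ne_nil _ _ _

/-- Reversing the inverse word gives the same pattern in the inverse letters, so the bound 2 applies
once to each word. -/
theorem encard_straddles_gWord_le {a b : α} (hab : a ≠ b) (l₁ l₂ : List (α × Bool)) :
    {i : ℕ | Straddles (gWord a b i).toWord l₁ l₂ ∨
      Straddles (gWord a b i)⁻¹.toWord l₁ l₂}.encard ≤ 4 := by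
  have h1 := encard_straddles_abWord_le (A := (a, true)) (B := (b, true)) (by simpa using hab) l₁ l₂
  have h2 := encard_straddles_abWord_le (A := (a, false)) (B := (b, false)) (by simpa using hab)
    l₂.reverse l₁.reverse
  calc _ ≤ ({i : ℕ | Straddles (abWord (a, true) (b, true) i) l₁ l₂} ∪
        {i : ℕ | Straddles (abWord (a, false) (b, false) i) l₂.reverse l₁.reverse}).encard := by
        apply Set.encard_le_encard
        rintro i (h | h)
        · left; simpa [toWord_gWord] using h
        · right
          have := h.reverse
          rw [FreeGroup.toWord_inv, toWord_gWord] at this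
          simpa [FreeGroup.invRev, abWord] using this
    _ ≤ _ := Set.encard_union_le _ _
    _ ≤ 2 + 2 := add_le_add h1 h2
    _ = 4 := by norm_num

theorem brooks_eq_of_toWord_append {w x y z : FreeGroup α} (hw : w ≠ 1)
    (hz : z.toWord = x.toWord ++ y.toWord)
    (h : ¬ (Straddles w.toWord x.toWord y.toWord ∨ Straddles w⁻¹.toWord x.toWord y.toWord)) :
    brooks w z = brooks w x + brooks w y := by
  rw [not_or] at h
  have hw' : w⁻¹ ≠ 1 := inv_ne_one.2 hw
  have h1 : occurrences w z = occurrences w x + occurrences w y := by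
    simp only [occurrences_eq_countInfix]
    rw [hz, countInfix_append (by simpa using hw) h.1]
  have h2 : occurrences w⁻¹ z = occurrences w⁻¹ x + occurrences w⁻¹ y := by
    simp only [occurrences_eq_countInfix]
    rw [hz, countInfix_append (by rwa [ne_eq, FreeGroup.toWord_eq_nil_iff]) h.2]
  simp only [brooks, h1, h2]
  push_cast
  ring

/-- In the tripod `pq`, `q⁻¹r`, `pr` there are three junctions, each bad for at most four indices;
elsewhere the two contributions of `q` cancel by oddness. -/
theorem encard_brooks_mul_ne_le {a b : α} (hab : a ≠ b) (f g : FreeGroup α) :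
    {i : ℕ | brooks (gWord a b i) (f * g) ≠
      brooks (gWord a b i) f + brooks (gWord a b i) g}.encard ≤ 12 := by
  obtain ⟨p, q, r, h1, h2, h3⟩ := exists_toWord_tripod f g
  have hs := encard_straddles_gWord_le hab
  set S : List (α × Bool) → List (α × Bool) → Set ℕ := fun l₁ l₂ =>
    {i : ℕ | Straddles (gWord a b i).toWord l₁ l₂ ∨ Straddles (gWord a b i)⁻¹.toWord l₁ l₂}
  calc _ ≤ (S p.toWord q.toWord ∪ S q⁻¹.toWord r.toWord ∪ S p.toWord r.toWord).encard := by
        apply Set.encard_le_encard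
        intro i hi
        by_contra hc
        simp only [Set.mem_union, not_or] at hc
        apply hi
        have hw := gWord_ne_one a b i
        rw [brooks_eq_of_toWord_append hw h1 hc.1.1, brooks_eq_of_toWord_append hw h2 hc.1.2,
          brooks_eq_of_toWord_append hw h3 hc.2, brooks_inv hw]
        ring
    _ ≤ _ := Set.encard_union_le _ _
    _ ≤ _ := add_le_add (Set.encard_union_le _ _) le_rfl
    _ ≤ 4 + 4 + 4 := add_le_add (add_le_add (hs _ _) (hs _ _)) (hs _ _)
    _ = 12 := by norm_num

/-- The word `g_i` has length `4 * i + 3`, too long to occur in `x`. -/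
theorem brooks_gWord_eq_zero (a b : α) {i : ℕ} {x : FreeGroup α}
    (h : x.toWord.length ≤ i) : brooks (gWord a b i) x = 0 := by
  have hl : x.toWord.length < (gWord a b i).toWord.length := by
    rw [toWord_gWord]; simp [abWord]; omega
  have h1 : occurrences (gWord a b i) x = 0 := by
    rw [occurrences_eq_countInfix, countInfix_eq_zero_of_length_lt hl]
  have h2 : occurrences (gWord a b i)⁻¹ x = 0 := by
    rw [occurrences_eq_countInfix,
      countInfix_eq_zero_of_length_lt (by simpa [FreeGroup.toWord_inv] using hl)]
  simp [brooks, h1, h2]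

section BrooksOn

variable {K N : Type*} [Group K] [Group N] (e : FreeGroup α × N ≃* K) {a b : α}

theorem brooksOn_inv (a b : α) (i : ℕ) (k : K) :
    brooksOn e a b i k⁻¹ = - brooksOn e a b i k := by
  simp [brooksOn, brooks_inv (gWord_ne_one a b i)]

theorem encard_brooksOn_mul_ne_le (hab : a ≠ b) (k l : K) :
    {i : ℕ | brooksOn e a b i (k * l) ≠ brooksOn e a b i k + brooksOn e a b i l}.encard ≤ 12 := by
  refine le_trans (Set.encard_le_encard ?_)
    (encard_brooks_mul_ne_le hab (e.symm k).1 (e.symm l).1)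
  intro i hi h
  apply hi
  simp only [brooksOn, map_mul, Prod.fst_mul, h]
  push_cast
  rfl

theorem exists_brooksOn_eq_zero (a b : α) {s : Set K} (hs : s.Finite) :
    ∃ i₀ : ℕ, ∀ i, i₀ ≤ i → ∀ k ∈ s, brooksOn e a b i k = 0 := by
  obtain ⟨i₀, h⟩ := (hs.image fun k => (e.symm k).1.toWord.length).bddAbove
  refine ⟨i₀, fun i hi k hk => ?_⟩
  have := h (Set.mem_image_of_mem _ hk)
  simp [brooksOn, brooks_gWord_eq_zero a b (this.trans hi)]

end BrooksOn

end FreeGroupWords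

/-! ### Cliques penetrated by geodesics. -/

section Projections

variable {V : Type*} {Γ : SimpleGraph V} {A : Set V} {x y u v w : V}

/-- The nearest-point projection of `x` to the set `A`. -/
def proj (Γ : SimpleGraph V) (A : Set V) (x : V) : Set V :=
  {u | u ∈ A ∧ ∀ w ∈ A, Γ.dist x u ≤ Γ.dist x w}

theorem proj_nonempty (Γ : SimpleGraph V) (hA : A.Nonempty) (x : V) : (proj Γ A x).Nonempty := by
  obtain ⟨u, hu, h⟩ := exists_minimalFor_of_wellFoundedLT (· ∈ A) (Γ.dist x) hA
  exact ⟨u, hu, fun w hw => (le_total _ _).elim id (h hw)⟩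

/-- Every geodesic from `x` to `y` contains an edge between points of `A`. -/
def Penetrates (Γ : SimpleGraph V) (A : Set V) (x y : V) : Prop :=
  ∀ p : Γ.Walk x y, IsGeodesic p → ∃ i < p.length, p.getVert i ∈ A ∧ p.getVert (i + 1) ∈ A

theorem exists_isGeodesic (hΓ : Γ.Connected) (x y : V) : ∃ p : Γ.Walk x y, IsGeodesic p :=
  hΓ.exists_walk_length_eq_dist x y

theorem dist_le_one_of_mem (hA : A.Pairwise Γ.Adj) (hu : u ∈ A) (hv : v ∈ A) :
    Γ.dist u v ≤ 1 := by
  by_cases h : u = v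
  · simp [h]
  · exact (SimpleGraph.dist_eq_one_iff_adj.2 (hA hu hv h)).le

theorem IsGeodesic.reverse {p : Γ.Walk x y} (hp : IsGeodesic p) : IsGeodesic p.reverse := by
  rw [IsGeodesic, SimpleGraph.Walk.length_reverse, hp, SimpleGraph.dist_comm]

theorem Penetrates.symm (h : Penetrates Γ A x y) : Penetrates Γ A y x := by
  intro p hp
  obtain ⟨i, hi, h1, h2⟩ := h p.reverse hp.reverse
  rw [SimpleGraph.Walk.length_reverse] at hi
  rw [SimpleGraph.Walk.getVert_reverse] at h1 h2
  refine ⟨p.length - (i + 1), by omega, h2, ?_⟩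
  rwa [show p.length - (i + 1) + 1 = p.length - i by omega]

theorem dist_getVert_le (hΓ : Γ.Connected) (p : Γ.Walk x y) {i j : ℕ} (hij : i ≤ j) :
    Γ.dist (p.getVert i) (p.getVert j) ≤ j - i := by
  induction j, hij using Nat.le_induction with
  | base => simp
  | succ j hij ih =>
    have h1 := hΓ.dist_triangle (u := p.getVert i) (v := p.getVert j) (w := p.getVert (j + 1))
    have h2 : Γ.dist (p.getVert j) (p.getVert (j + 1)) ≤ 1 := by
      rcases lt_or_ge j p.length with h | h
      · exact (SimpleGraph.dist_eq_one_iff_adj.2 (p.adj_getVert_succ h)).le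
      · rw [p.getVert_of_length_le h, p.getVert_of_length_le (by omega)]; simp
    omega

theorem IsGeodesic.dist_getVert (hΓ : Γ.Connected) {p : Γ.Walk x y} (hp : IsGeodesic p) {i j : ℕ}
    (hij : i ≤ j) (hj : j ≤ p.length) : Γ.dist (p.getVert i) (p.getVert j) = j - i := by
  have h1 := dist_getVert_le hΓ p hij
  have h2 := dist_getVert_le hΓ p (Nat.zero_le i)
  have h3 := dist_getVert_le hΓ p hj
  have h4 := hΓ.dist_triangle (u := x) (v := p.getVert i) (w := y)
  have h5 := hΓ.dist_triangle (u := p.getVert i) (v := p.getVert j) (w := y)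
  rw [p.getVert_zero] at h2
  rw [p.getVert_length] at h3
  rw [IsGeodesic] at hp
  omega

theorem IsGeodesic.dist_left (hΓ : Γ.Connected) {p : Γ.Walk x y} (hp : IsGeodesic p) {i : ℕ}
    (hi : i ≤ p.length) : Γ.dist x (p.getVert i) = i := by
  simpa using hp.dist_getVert hΓ (Nat.zero_le i) hi

theorem IsGeodesic.dist_right (hΓ : Γ.Connected) {p : Γ.Walk x y} (hp : IsGeodesic p) {i : ℕ}
    (hi : i ≤ p.length) : Γ.dist (p.getVert i) y = p.length - i := by
  simpa using hp.dist_getVert hΓ hi le_rfl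

theorem IsGeodesic.dist_add_of_mem (hΓ : Γ.Connected) {p : Γ.Walk x y} (hp : IsGeodesic p)
    (hw : w ∈ p.support) : Γ.dist x w + Γ.dist w y = Γ.dist x y := by
  obtain ⟨i, rfl, hi⟩ := SimpleGraph.Walk.mem_support_iff_exists_getVert.1 hw
  rw [hp.dist_left hΓ hi, hp.dist_right hΓ hi, ← hp]
  omega

theorem exists_isGeodesic_mem (hΓ : Γ.Connected) (h : Γ.dist x w + Γ.dist w y = Γ.dist x y) :
    ∃ p : Γ.Walk x y, IsGeodesic p ∧ w ∈ p.support := by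
  obtain ⟨p, hp⟩ := exists_isGeodesic hΓ x w
  obtain ⟨q, hq⟩ := exists_isGeodesic hΓ w y
  refine ⟨p.append q, ?_, by simp [SimpleGraph.Walk.mem_support_append_iff]⟩
  rw [IsGeodesic, SimpleGraph.Walk.length_append, hp, hq, h]

theorem exists_isGeodesic_through (hΓ : Γ.Connected) (huv : Γ.Adj u v)
    (h : Γ.dist x y = Γ.dist x u + 1 + Γ.dist v y) :
    ∃ p : Γ.Walk x y, IsGeodesic p ∧ p.getVert (Γ.dist x u) = u ∧
      p.getVert (Γ.dist x u + 1) = v := by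
  obtain ⟨p, hp⟩ := exists_isGeodesic hΓ x u
  obtain ⟨q, hq⟩ := exists_isGeodesic hΓ v y
  rw [IsGeodesic] at hp hq
  refine ⟨p.append (SimpleGraph.Walk.cons huv q), ?_, ?_, ?_⟩
  · rw [IsGeodesic, SimpleGraph.Walk.length_append, SimpleGraph.Walk.length_cons, hp, hq, h]
    omega
  · simp [SimpleGraph.Walk.getVert_append, hp]
  · simp [SimpleGraph.Walk.getVert_append, hp]

/-- On a geodesic, an edge in the clique `A` joins the projections of the two ends. -/
theorem IsGeodesic.mem_proj (hΓ : Γ.Connected) (hA : A.Pairwise Γ.Adj) {p : Γ.Walk x y}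
    (hp : IsGeodesic p) {i : ℕ} (hi : i < p.length) (h1 : p.getVert i ∈ A)
    (h2 : p.getVert (i + 1) ∈ A) :
    p.getVert i ∈ proj Γ A x ∧ p.getVert (i + 1) ∈ proj Γ A y := by
  have e1 := hp.dist_left hΓ hi.le
  have e2 := hp.dist_right hΓ (i := i + 1) hi
  rw [IsGeodesic] at hp
  refine ⟨⟨h1, fun w hw => ?_⟩, h2, fun w hw => ?_⟩
  · have t1 := hΓ.dist_triangle (u := x) (v := w) (w := y)
    have t2 := hΓ.dist_triangle (u := w) (v := p.getVert (i + 1)) (w := y)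
    have t3 := dist_le_one_of_mem hA hw h2
    omega
  · have t1 := hΓ.dist_triangle (u := x) (v := w) (w := y)
    have t2 := hΓ.dist_triangle (u := x) (v := p.getVert i) (w := w)
    have t3 := dist_le_one_of_mem hA h1 hw
    rw [SimpleGraph.dist_comm (u := y), SimpleGraph.dist_comm (u := y)]
    omega

theorem dist_eq_of_mem_proj (hu : u ∈ proj Γ A x) (hv : v ∈ proj Γ A x) :
    Γ.dist x u = Γ.dist x v :=
  le_antisymm (hu.2 v hv.1) (hv.2 u hu.1)

/-- All points of a projection are equally far from the projected point, so what one geodesic shows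
for its own edge in `A` holds for every pair of projection points. Each such pair is thus an edge of
some geodesic. -/
theorem Penetrates.dist_eq (hΓ : Γ.Connected) (hA : A.Pairwise Γ.Adj) (h : Penetrates Γ A x y)
    (hu : u ∈ proj Γ A x) (hv : v ∈ proj Γ A y) :
    Γ.dist x y = Γ.dist x u + 1 + Γ.dist v y := by
  obtain ⟨p, hp⟩ := exists_isGeodesic hΓ x y
  obtain ⟨i, hi, h1, h2⟩ := h p hp
  obtain ⟨h1, h2⟩ := hp.mem_proj hΓ hA hi h1 h2
  rw [dist_eq_of_mem_proj hu h1, SimpleGraph.dist_comm, SimpleGraph.dist_comm (u := v),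
    dist_eq_of_mem_proj hv h2, SimpleGraph.dist_comm, SimpleGraph.dist_comm (u := y),
    hp.dist_left hΓ hi.le, hp.dist_right hΓ hi, ← hp]
  omega

theorem Penetrates.adj (hΓ : Γ.Connected) (hA : A.Pairwise Γ.Adj) (h : Penetrates Γ A x y)
    (hu : u ∈ proj Γ A x) (hv : v ∈ proj Γ A y) : Γ.Adj u v := by
  refine hA hu.1 hv.1 ?_
  rintro rfl
  have h1 := h.dist_eq hΓ hA hu hv
  have h2 := hΓ.dist_triangle (u := x) (v := u) (w := y)
  omega

theorem Penetrates.exists_mem_proj (hΓ : Γ.Connected) (hA : A.Pairwise Γ.Adj)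
    (h : Penetrates Γ A x y) {p : Γ.Walk x y} (hp : IsGeodesic p) (hu : u ∈ proj Γ A x) :
    Γ.dist x u < p.length ∧ p.getVert (Γ.dist x u) ∈ proj Γ A x ∧
      p.getVert (Γ.dist x u + 1) ∈ proj Γ A y := by
  obtain ⟨i, hi, h1, h2⟩ := h p hp
  obtain ⟨h1, h2⟩ := hp.mem_proj hΓ hA hi h1 h2
  have := dist_eq_of_mem_proj hu h1
  rw [hp.dist_left hΓ hi.le] at this
  rw [this]
  exact ⟨hi, h1, h2⟩

/-- The point of this criterion is that its right-hand side does not mention `y`: when a farther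
clique `A₂` is also penetrated, the projection of `y` to `A₁` is determined by `x` and `A₂`. -/
theorem mem_proj_iff_of_penetrates (hΓ : Γ.Connected) {A₁ A₂ : Set V} (hA₁ : A₁.Pairwise Γ.Adj)
    (hA₂ : A₂.Pairwise Γ.Adj) (h₁ : Penetrates Γ A₁ x y) (h₂ : Penetrates Γ A₂ x y) {u₁ u₂ : V}
    (hu₁ : u₁ ∈ proj Γ A₁ x) (hu₂ : u₂ ∈ proj Γ A₂ x) (hlt : Γ.dist x u₁ < Γ.dist x u₂) :
    v ∈ proj Γ A₁ y ↔ v ∈ A₁ ∧ ∃ w ∈ proj Γ A₂ x, Γ.dist v w + Γ.dist x u₁ + 1 = Γ.dist x u₂ := by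
  constructor
  · intro hv
    refine ⟨hv.1, ?_⟩
    obtain ⟨p, hp, e1, e2⟩ := exists_isGeodesic_through hΓ (h₁.adj hΓ hA₁ hu₁ hv)
      (h₁.dist_eq hΓ hA₁ hu₁ hv)
    obtain ⟨hi, h3, h4⟩ := h₂.exists_mem_proj hΓ hA₂ hp hu₂
    refine ⟨_, h3, ?_⟩
    have := hp.dist_getVert hΓ (i := Γ.dist x u₁ + 1) hlt hi.le
    rw [e2] at this
    omega
  · rintro ⟨hv, w, hw, e⟩
    refine ⟨hv, fun v' hv' => ?_⟩
    obtain ⟨a, ha⟩ := proj_nonempty Γ ⟨v, hv⟩ y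
    obtain ⟨b, hb⟩ := proj_nonempty Γ ⟨w, hw.1⟩ y
    have t1 := h₁.dist_eq hΓ hA₁ hu₁ ha
    have t2 := h₂.dist_eq hΓ hA₂ hu₂ hb
    have t3 := hΓ.dist_triangle (u := v) (v := w) (w := y)
    have t4 := hΓ.dist_triangle (u := w) (v := b) (w := y)
    have t5 := dist_le_one_of_mem hA₂ hw.1 hb.1
    have t6 := ha.2 v' hv'
    rw [SimpleGraph.dist_comm] at t6 ⊢
    omega

/-- If a family of pairwise disjoint cliques is penetrated by the geodesics from `x` to `y` and by
those from `x` to `z`, then only for the last one can the projections of `y` and `z` differ. -/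
theorem subsingleton_setOf_proj_ne (hΓ : Γ.Connected) {ι : Type*} {A : ι → Set V}
    (hA : ∀ c, (A c).Pairwise Γ.Adj) (hne : ∀ c, (A c).Nonempty)
    (hdisj : ∀ c c' g, g ∈ A c → g ∈ A c' → c = c') (x y z : V) :
    {c | Penetrates Γ (A c) x y ∧ Penetrates Γ (A c) x z ∧
      proj Γ (A c) y ≠ proj Γ (A c) z}.Subsingleton := by
  have key : ∀ c c' u u', Penetrates Γ (A c) x y → Penetrates Γ (A c) x z →
      proj Γ (A c) y ≠ proj Γ (A c) z → Penetrates Γ (A c') x y → Penetrates Γ (A c') x z →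
      u ∈ proj Γ (A c) x → u' ∈ proj Γ (A c') x → ¬ Γ.dist x u < Γ.dist x u' := by
    intro c c' u u' h1 h2 h3 h1' h2' hu hu' hlt
    apply h3
    ext v
    rw [mem_proj_iff_of_penetrates hΓ (hA c) (hA c') h1 h1' hu hu' hlt,
      mem_proj_iff_of_penetrates hΓ (hA c) (hA c') h2 h2' hu hu' hlt]
  rintro c ⟨h1, h2, h3⟩ c' ⟨h1', h2', h3'⟩
  obtain ⟨u, hu⟩ := proj_nonempty Γ (hne c) x
  obtain ⟨u', hu'⟩ := proj_nonempty Γ (hne c') x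
  -- Neither clique can precede the other, so both contain the same vertex of a geodesic, and
  -- disjointness identifies them.
  have e : Γ.dist x u = Γ.dist x u' :=
    le_antisymm (not_lt.1 (key c' c u' u h1' h2' h3' h1 h2 hu' hu))
      (not_lt.1 (key c c' u u' h1 h2 h3 h1' h2' hu hu'))
  obtain ⟨p, hp⟩ := exists_isGeodesic hΓ x y
  have m := (h1.exists_mem_proj hΓ (hA c) hp hu).2.1.1
  have m' := (h1'.exists_mem_proj hΓ (hA c') hp hu').2.1.1
  rw [← e] at m'
  exact hdisj c c' _ m m'

theorem finite_setOf_penetrates (hΓ : Γ.Connected) {ι : Type*} {A : ι → Set V}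
    (hdisj : ∀ c c' g, g ∈ A c → g ∈ A c' → c = c') (x y : V) :
    {c | Penetrates Γ (A c) x y}.Finite := by
  obtain ⟨p, hp⟩ := exists_isGeodesic hΓ x y
  have h : ∀ c : {c | Penetrates Γ (A c) x y}, ∃ i : Fin p.length, p.getVert i ∈ A c := by
    rintro ⟨c, hc⟩
    obtain ⟨i, hi, h1, -⟩ := hc p hp
    exact ⟨⟨i, hi⟩, h1⟩
  choose f hf using h
  refine Set.finite_coe_iff.1 (Finite.of_injective f fun c c' h => ?_)
  have h2 := hf c'
  rw [← h] at h2
  exact Subtype.ext (hdisj _ _ _ (hf c) h2)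

end Projections

/-! ### Slimness forces penetration when projections are far apart. -/

section Slim

variable {V : Type*} {Γ Γ' : SimpleGraph V} {A : Set V} {x y z u v w : V} {δ : ℕ}

/-- Geodesic triangles are `δ`-slim. -/
def IsSlim (Γ : SimpleGraph V) (δ : ℕ) : Prop :=
  ∀ (x y z : V) (p : Γ.Walk x y) (q : Γ.Walk y z) (r : Γ.Walk x z),
    IsGeodesic p → IsGeodesic q → IsGeodesic r →
      ∀ v ∈ p.support, ∃ w, (w ∈ q.support ∨ w ∈ r.support) ∧ Γ.dist v w ≤ δ

theorem IsSlim.exists_near_side (hs : IsSlim Γ δ) (hΓ : Γ.Connected) {r : Γ.Walk x z}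
    (hr : IsGeodesic r) (y : V) (h : Γ.dist x v + Γ.dist v y = Γ.dist x y) :
    ∃ w, (Γ.dist y w + Γ.dist w z = Γ.dist y z ∨ w ∈ r.support) ∧ Γ.dist v w ≤ δ := by
  obtain ⟨p, hp, hv⟩ := exists_isGeodesic_mem hΓ h
  obtain ⟨q, hq⟩ := exists_isGeodesic hΓ y z
  obtain ⟨w, hw, hd⟩ := hs x y z p q r hp hq hr v hv
  exact ⟨w, hw.imp_left (hq.dist_add_of_mem hΓ), hd⟩

theorem IsSlim.exists_near_quadrilateral (hs : IsSlim Γ δ) (hΓ : Γ.Connected) {r : Γ.Walk x y}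
    (hr : IsGeodesic r) (u v : V) (h : Γ.dist x w + Γ.dist w u = Γ.dist x u) :
    ∃ w', (Γ.dist u w' + Γ.dist w' v = Γ.dist u v ∨ Γ.dist v w' + Γ.dist w' y = Γ.dist v y ∨
      w' ∈ r.support) ∧ Γ.dist w w' ≤ 2 * δ := by
  obtain ⟨q, hq⟩ := exists_isGeodesic hΓ x v
  obtain ⟨w₁, h1 | h1, d1⟩ := hs.exists_near_side hΓ hq u h
  · exact ⟨w₁, Or.inl h1, by omega⟩
  · obtain ⟨w₂, h2, d2⟩ := hs.exists_near_side hΓ hr v (hq.dist_add_of_mem hΓ h1)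
    have := hΓ.dist_triangle (u := w) (v := w₁) (w := w₂)
    exact ⟨w₂, Or.inr h2, by omega⟩

/-- `Γ'` plays the role of `Γ` without the edges inside `A`; a walk using no such edge survives in
`Γ'`. -/
theorem edist_getVert_le (hout : ∀ g h, Γ.Adj g h → ¬ (g ∈ A ∧ h ∈ A) → Γ'.Adj g h)
    {p : Γ.Walk x y} (hp : ∀ i < p.length, ¬ (p.getVert i ∈ A ∧ p.getVert (i + 1) ∈ A))
    {i j : ℕ} (hij : i ≤ j) (hj : j ≤ p.length) :
    Γ'.edist (p.getVert i) (p.getVert j) ≤ (j - i : ℕ) := by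
  induction j, hij using Nat.le_induction with
  | base => simp
  | succ j hij ih =>
    have h1 := SimpleGraph.edist_triangle (G := Γ') (u := p.getVert i) (v := p.getVert j)
      (w := p.getVert (j + 1))
    have h2 : Γ'.edist (p.getVert j) (p.getVert (j + 1)) = 1 :=
      SimpleGraph.edist_eq_one_iff_adj.2 (hout _ _ (p.adj_getVert_succ hj) (hp j hj))
    calc _ ≤ _ := h1
      _ ≤ ((j - i : ℕ) : ℕ∞) + 1 := add_le_add (ih (by omega)) h2.le
      _ = _ := by rw [show j + 1 - i = (j - i) + 1 by omega]; push_cast; rfl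

/-- A geodesic to `y` can meet `A` only at its endpoint, hence has no edge inside `A`. -/
theorem edist_le_dist_of_notMem (hΓ : Γ.Connected)
    (hout : ∀ g h, Γ.Adj g h → ¬ (g ∈ A ∧ h ∈ A) → Γ'.Adj g h)
    (h : ∀ a ∈ A, Γ.dist x y ≤ Γ.dist x a) : Γ'.edist x y ≤ Γ.dist x y := by
  obtain ⟨p, hp⟩ := exists_isGeodesic hΓ x y
  have := edist_getVert_le hout (p := p) (fun i hi ⟨h1, _⟩ => by
    have := h _ h1
    rw [hp.dist_left hΓ hi.le, ← hp] at this
    omega) (Nat.zero_le _) le_rfl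
  rw [p.getVert_zero, p.getVert_length, Nat.sub_zero, show p.length = _ from hp] at this
  exact this

theorem edist_le_dist_of_mem_proj (hΓ : Γ.Connected)
    (hout : ∀ g h, Γ.Adj g h → ¬ (g ∈ A ∧ h ∈ A) → Γ'.Adj g h) (hu : u ∈ proj Γ A x)
    (hw : Γ.dist x w + Γ.dist w u = Γ.dist x u) : Γ'.edist w u ≤ Γ.dist w u := by
  refine edist_le_dist_of_notMem hΓ hout fun a ha => ?_
  have h1 := hu.2 a ha
  have h2 := hΓ.dist_triangle (u := x) (v := w) (w := a)
  omega

theorem exists_dist_eq (hΓ : Γ.Connected) {n : ℕ} (h : n ≤ Γ.dist x u) :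
    ∃ w, Γ.dist x w + Γ.dist w u = Γ.dist x u ∧ Γ.dist w u = n := by
  obtain ⟨p, hp⟩ := exists_isGeodesic hΓ x u
  have hl : p.length - n ≤ p.length := by omega
  refine ⟨p.getVert (p.length - n), ?_⟩
  rw [hp.dist_left hΓ hl, hp.dist_right hΓ hl, ← hp]
  rw [← hp] at h
  omega

/-- Go back from `u` towards `x` to a point `w` at distance `2 * δ + 1`, or to `x` itself if it is
nearer. The `2 * δ`-ball around `w` misses `A`, so the nearby point `w'` of the quadrilateral is not
on the side from `u` to `v`. If it is on `r`, the second alternative holds; if on the side from `v`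
to `y`, it lies within `4 * δ + 2` of `v`, and `(4 * δ + 1) + (4 * δ + 2)` gives the bound. -/
theorem IsSlim.edist_proj_le_or (hs : IsSlim Γ δ) (hΓ : Γ.Connected) (hA : A.Pairwise Γ.Adj)
    (hout : ∀ g h, Γ.Adj g h → ¬ (g ∈ A ∧ h ∈ A) → Γ'.Adj g h) {r : Γ.Walk x y}
    (hr : IsGeodesic r) (hu : u ∈ proj Γ A x) (hv : v ∈ proj Γ A y) :
    Γ'.edist u v ≤ (8 * δ + 3 : ℕ) ∨
      ∃ w ∈ r.support, Γ'.edist u w ≤ (8 * δ + 3 : ℕ) := by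
  have huv := dist_le_one_of_mem hA hu.1 hv.1
  rcases le_or_gt (Γ.dist x u) (2 * δ + 1) with h | h
  · right
    refine ⟨x, r.start_mem_support, ?_⟩
    rw [SimpleGraph.edist_comm]
    refine (edist_le_dist_of_mem_proj hΓ hout hu (by simp)).trans ?_
    exact_mod_cast (by omega)
  · obtain ⟨w, hw, hwu⟩ := exists_dist_eq hΓ h.le
    have h1 : Γ'.edist u w ≤ (2 * δ + 1 : ℕ) := by
      rw [SimpleGraph.edist_comm, ← hwu]
      exact edist_le_dist_of_mem_proj hΓ hout hu hw
    have hfar : ∀ a ∈ A, 2 * δ < Γ.dist w a := by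
      intro a ha
      have h1 := hu.2 a ha
      have h2 := hΓ.dist_triangle (u := x) (v := w) (w := a)
      omega
    obtain ⟨w', hw', hd⟩ := hs.exists_near_quadrilateral hΓ hr u v hw
    have h2 : Γ'.edist w w' ≤ (2 * δ : ℕ) :=
      (edist_le_dist_of_notMem hΓ hout fun a ha => hd.trans (hfar a ha).le).trans
        (by exact_mod_cast hd)
    have h3 : Γ'.edist u w' ≤ (4 * δ + 1 : ℕ) :=
      calc _ ≤ _ := SimpleGraph.edist_triangle
        _ ≤ _ := add_le_add h1 h2
        _ ≤ _ := by exact_mod_cast (by omega)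
    rcases hw' with hw' | hw' | hw'
    · exfalso
      have : w' = u ∨ w' = v := by
        rw [eq_comm, ← hΓ.dist_eq_zero_iff, ← hΓ.dist_eq_zero_iff]
        omega
      rcases this with rfl | rfl
      · have := hfar _ hu.1; omega
      · have := hfar _ hv.1; omega
    · left
      have h4 : Γ'.edist w' v ≤ (4 * δ + 2 : ℕ) := by
        refine (edist_le_dist_of_mem_proj hΓ hout hv ?_).trans ?_
        · rw [Γ.dist_comm (u := y) (v := w'), Γ.dist_comm (u := w') (v := v),
            Γ.dist_comm (u := y) (v := v)]
          omega
        have t1 := hΓ.dist_triangle (u := w') (v := w) (w := v)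
        have t2 := hΓ.dist_triangle (u := w) (v := u) (w := v)
        rw [Γ.dist_comm (u := w') (v := w)] at t1
        exact_mod_cast (by omega)
      calc _ ≤ _ := SimpleGraph.edist_triangle
        _ ≤ _ := add_le_add h3 h4
        _ ≤ _ := by exact_mod_cast (by omega)
    · exact Or.inr ⟨w', hw', h3.trans (by exact_mod_cast (by omega))⟩

/-- If the projections of `x` and `y` to a clique are far from each other outside the clique, then
every geodesic from `x` to `y` penetrates the clique. -/
theorem IsSlim.penetrates (hs : IsSlim Γ δ) (hΓ : Γ.Connected) (hA : A.Pairwise Γ.Adj)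
    (hle : Γ' ≤ Γ) (hout : ∀ g h, Γ.Adj g h → ¬ (g ∈ A ∧ h ∈ A) → Γ'.Adj g h)
    (hu : u ∈ proj Γ A x) (hv : v ∈ proj Γ A y)
    (h : ((32 * δ + 13 : ℕ) : ℕ∞) < Γ'.edist u v) : Penetrates Γ A x y := by
  intro r hr
  by_contra hc
  push Not at hc
  have hc' : ∀ i < r.length, ¬ (r.getVert i ∈ A ∧ r.getVert (i + 1) ∈ A) :=
    fun i hi h => hc i hi h.1 h.2
  have huv := dist_le_one_of_mem hA hu.1 hv.1
  have hdist : ∀ {a b : V} {n : ℕ}, Γ'.edist a b ≤ n → Γ.dist a b ≤ n := by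
    intro a b n hab
    have := (SimpleGraph.edist_anti hle (u := a) (v := b)).trans hab
    rw [← (hΓ a b).coe_dist_eq_edist] at this
    exact_mod_cast this
  refine absurd h (not_lt.2 ?_)
  -- If `r` has no edge in `A`, go from `u` to `r`, along `r`, and on to `v`: the lengths `8 * δ +
  -- 3`, `16 * δ + 7` and `8 * δ + 3` add up to `32 * δ + 13`.
  rcases hs.edist_proj_le_or hΓ hA hout hr hu hv with h1 | ⟨w, hw, h1⟩
  · exact h1.trans (by exact_mod_cast (by omega))
  rcases hs.edist_proj_le_or hΓ hA hout hr.reverse hv hu with h2 | ⟨w', hw', h2⟩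
  · rw [SimpleGraph.edist_comm]
    exact h2.trans (by exact_mod_cast (by omega))
  rw [SimpleGraph.Walk.support_reverse, List.mem_reverse] at hw'
  have h3 : Γ'.edist w w' ≤ (16 * δ + 7 : ℕ) := by
    have hww : Γ.dist w w' ≤ 16 * δ + 7 := by
      have d1 := hdist h1
      have d2 := hdist h2
      have t1 := hΓ.dist_triangle (u := w) (v := u) (w := w')
      have t2 := hΓ.dist_triangle (u := u) (v := v) (w := w')
      rw [Γ.dist_comm (u := w) (v := u)] at t1
      omega
    obtain ⟨i, rfl, hi⟩ := SimpleGraph.Walk.mem_support_iff_exists_getVert.1 hw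
    obtain ⟨j, rfl, hj⟩ := SimpleGraph.Walk.mem_support_iff_exists_getVert.1 hw'
    rcases le_total i j with hij | hij
    · rw [hr.dist_getVert hΓ hij hj] at hww
      exact (edist_getVert_le hout hc' hij hj).trans (by exact_mod_cast hww)
    · rw [Γ.dist_comm, hr.dist_getVert hΓ hij hi] at hww
      rw [SimpleGraph.edist_comm]
      exact (edist_getVert_le hout hc' hij hi).trans (by exact_mod_cast hww)
  rw [SimpleGraph.edist_comm] at h2
  calc _ ≤ _ := SimpleGraph.edist_triangle
    _ ≤ _ := add_le_add h1 (SimpleGraph.edist_triangle.trans (add_le_add h3 h2))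
    _ ≤ _ := by exact_mod_cast (by omega)

end Slim

/-! ### Distances under graph maps. -/

section GraphMaps

variable {V W : Type*} {Γ : SimpleGraph V} {Γ' : SimpleGraph W}

theorem edist_map_le (f : Γ →g Γ') (u v : V) : Γ'.edist (f u) (f v) ≤ Γ.edist u v := by
  by_cases h : Γ.edist u v = ⊤
  · rw [h]; exact le_top
  · obtain ⟨p, hp⟩ := SimpleGraph.exists_walk_of_edist_ne_top h
    rw [← hp, ← SimpleGraph.Walk.length_map f]
    exact SimpleGraph.edist_le _

theorem edist_iso (φ : Γ ≃g Γ') (u v : V) : Γ'.edist (φ u) (φ v) = Γ.edist u v := by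
  refine le_antisymm (edist_map_le φ.toHom u v) ?_
  simpa using edist_map_le φ.symm.toHom (φ u) (φ v)

theorem dist_iso (φ : Γ ≃g Γ') (u v : V) : Γ'.dist (φ u) (φ v) = Γ.dist u v := by
  simp only [SimpleGraph.dist, edist_iso]

end GraphMaps

/-! ### Cosets of `K`, their projections and the relative metric. -/

section Cosets

variable {G : Type*} [Group G] {X : Set G} {K : Subgroup G} {c : G ⧸ K} {C : ℕ} {x y u v g : G}

/-- The distance from `1` to `g` in the graph which defines the relative metric on `K`. -/
noncomputable def outsideNorm (X : Set G) (K : Subgroup G) (g : G) : ℕ∞ :=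
  (cayleyOutside X K).edist 1 g

/-- `Γ(G, X ⊔ K)` with the `K`-edges of the coset `c` removed. -/
noncomputable def cosetOutside (X : Set G) (K : Subgroup G) (c : G ⧸ K) : SimpleGraph G :=
  (cayleyOutside X K).comap (fun g => c.out⁻¹ * g)

theorem cayley_adj : (cayley X K).Adj u v ↔
    u ≠ v ∧ ((u⁻¹ * v ∈ X ∨ v⁻¹ * u ∈ X) ∨ u⁻¹ * v ∈ K) := by
  have : v⁻¹ * u ∈ K ↔ u⁻¹ * v ∈ K := by
    rw [← inv_mem_iff]; simp
  simp only [cayley, SimpleGraph.mulCayley_adj, Set.mem_union, SetLike.mem_coe, this]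
  tauto

theorem cayleyOutside_adj : (cayleyOutside X K).Adj u v ↔
    u ≠ v ∧ ((u⁻¹ * v ∈ X ∨ v⁻¹ * u ∈ X) ∨ (u⁻¹ * v ∈ K ∧ u ∉ K)) := by
  have h1 : v⁻¹ * u ∈ K ↔ u⁻¹ * v ∈ K := by
    rw [← inv_mem_iff]; simp
  have h2 : u⁻¹ * v ∈ K → (v ∈ K ↔ u ∈ K) := fun h => by
    conv_lhs => rw [← mul_inv_cancel_left u v]
    exact K.mul_mem_cancel_right h
  simp only [cayleyOutside, SimpleGraph.sup_adj, SimpleGraph.mulCayley_adj,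
    SimpleGraph.fromRel_adj, h1]
  tauto

theorem mem_cosetSet_iff : g ∈ cosetSet c ↔ c.out⁻¹ * g ∈ K := by
  rw [cosetSet, Set.mem_ofPred_eq, ← QuotientGroup.eq, QuotientGroup.out_eq', eq_comm]

theorem out_mul_mem_cosetSet (c : G ⧸ K) (k : K) : c.out * (k : G) ∈ cosetSet c := by
  simp [mem_cosetSet_iff]

theorem cosetSet_nonempty (c : G ⧸ K) : (cosetSet c).Nonempty :=
  ⟨_, out_mul_mem_cosetSet c 1⟩

theorem inv_mul_mem_of_mem_cosetSet (hu : u ∈ cosetSet c) (hv : v ∈ cosetSet c) :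
    u⁻¹ * v ∈ K := by
  rw [← QuotientGroup.eq]
  exact Eq.trans hu (Eq.symm hv)

theorem mul_mem_cosetSet_smul : g * u ∈ cosetSet (g • c) ↔ u ∈ cosetSet c := by
  simp only [cosetSet, Set.mem_ofPred_eq]
  rw [← smul_eq_mul, ← MulAction.Quotient.smul_coe, smul_left_cancel_iff]

theorem cosetSet_pairwise_adj (c : G ⧸ K) : (cosetSet c).Pairwise (cayley X K).Adj :=
  fun _ hu _ hv h => cayley_adj.2 ⟨h, Or.inr (inv_mul_mem_of_mem_cosetSet hu hv)⟩

theorem cosetOutside_le (c : G ⧸ K) : cosetOutside X K c ≤ cayley X K := by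
  intro u v h
  obtain ⟨h1, h2⟩ := cayleyOutside_adj.1 (SimpleGraph.comap_adj.1 h)
  simp only [mul_inv_rev, inv_inv, mul_assoc, mul_inv_cancel_left] at h1 h2
  exact cayley_adj.2 ⟨fun e => h1 (by rw [e]), h2.imp_right And.left⟩

theorem cosetOutside_adj_of_adj (h : (cayley X K).Adj u v)
    (hc : ¬ (u ∈ cosetSet c ∧ v ∈ cosetSet c)) : (cosetOutside X K c).Adj u v := by
  obtain ⟨h1, h2⟩ := cayley_adj.1 h
  refine SimpleGraph.comap_adj.2 (cayleyOutside_adj.2 ⟨fun e => h1 (mul_left_cancel e), ?_⟩)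
  simp only [mul_inv_rev, inv_inv, mul_assoc, mul_inv_cancel_left]
  refine h2.imp_right fun hK => ⟨hK, fun hu => hc ⟨mem_cosetSet_iff.2 hu, mem_cosetSet_iff.2 ?_⟩⟩
  simpa [mul_assoc] using mul_mem hu hK

/-- Left multiplication by an element of `K` preserves `K`, hence the graph with the edges in `K`
removed. -/
theorem relDist_eq_outsideNorm (k l : K) : relDist X K k l = outsideNorm X K ((k : G)⁻¹ * l) := by
  let φ : cayleyOutside X K ≃g cayleyOutside X K :=
    ⟨Equiv.mulLeft (k : G), fun {u v} => by
      simp only [Equiv.coe_mulLeft, cayleyOutside_adj, mul_inv_rev, mul_assoc,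
        inv_mul_cancel_left, K.mul_mem_cancel_left k.2, ne_eq, mul_right_inj]⟩
  have := edist_iso φ 1 ((k : G)⁻¹ * l)
  rw [outsideNorm, ← this, relDist]
  simp [φ]

theorem outsideNorm_inv (hg : g ∈ K) : outsideNorm X K g⁻¹ = outsideNorm X K g := by
  have h1 := relDist_eq_outsideNorm (X := X) 1 ⟨g, hg⟩
  have h2 := relDist_eq_outsideNorm (X := X) ⟨g, hg⟩ 1
  simp only [OneMemClass.coe_one, inv_one, one_mul, mul_one] at h1 h2
  rw [← h1, ← h2, relDist, relDist, SimpleGraph.edist_comm]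

theorem edist_cosetOutside (hu : u ∈ cosetSet c) (hv : v ∈ cosetSet c) :
    (cosetOutside X K c).edist u v = outsideNorm X K (u⁻¹ * v) := by
  have := edist_iso (SimpleGraph.Iso.comap (Equiv.mulLeft c.out⁻¹) (cayleyOutside X K)) u v
  change _ = (cosetOutside X K c).edist u v at this
  rw [← this]
  have h := relDist_eq_outsideNorm (X := X) ⟨_, mem_cosetSet_iff.1 hu⟩ ⟨_, mem_cosetSet_iff.1 hv⟩
  simp only [mul_inv_rev, inv_inv, mul_assoc, mul_inv_cancel_left] at h
  rw [← h]
  rfl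

theorem outsideNorm_triangle {w : G} (hu : u ∈ cosetSet c) (hv : v ∈ cosetSet c)
    (hw : w ∈ cosetSet c) : outsideNorm X K (u⁻¹ * w) ≤
      outsideNorm X K (u⁻¹ * v) + outsideNorm X K (v⁻¹ * w) := by
  rw [← edist_cosetOutside hu hw, ← edist_cosetOutside hu hv, ← edist_cosetOutside hv hw]
  exact SimpleGraph.edist_triangle

theorem finite_outsideNorm_le (hK : IsHypEmbedded X K) (n : ℕ) :
    {g : G | g ∈ K ∧ outsideNorm X K g ≤ n}.Finite := by
  refine ((hK.locally_finite 1 n).image Subtype.val).subset ?_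
  rintro g ⟨hg, h⟩
  refine ⟨⟨g, hg⟩, ?_, rfl⟩
  rw [Set.mem_ofPred_eq, relDist_eq_outsideNorm]
  simpa using h

theorem dist_cayley_mul (g u v : G) :
    (cayley X K).dist (g * u) (g * v) = (cayley X K).dist u v := by
  let φ : cayley X K ≃g cayley X K :=
    ⟨Equiv.mulLeft g, fun {u v} => SimpleGraph.mulCayley_adj_mul_iff_right⟩
  exact dist_iso φ u v

/-- The nearest-point projection of `x` to the coset `c`. -/
abbrev cosetProj (X : Set G) (K : Subgroup G) (c : G ⧸ K) (x : G) : Set G :=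
  proj (cayley X K) (cosetSet c) x

theorem mul_mem_cosetProj_smul :
    g * u ∈ cosetProj X K (g • c) (g * x) ↔ u ∈ cosetProj X K c x := by
  simp only [cosetProj, proj, Set.mem_ofPred_eq, mul_mem_cosetSet_smul, dist_cayley_mul]
  refine and_congr_right fun _ => ⟨fun h w hw => ?_, fun h w hw => ?_⟩
  · simpa only [dist_cayley_mul] using h (g * w) (mul_mem_cosetSet_smul.2 hw)
  · have hw' : g⁻¹ * w ∈ cosetSet c := by
      rw [← mul_mem_cosetSet_smul (g := g), mul_inv_cancel_left]; exact hw
    have := h _ hw'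
    rwa [← dist_cayley_mul g x (g⁻¹ * w), mul_inv_cancel_left] at this

/-- `B` bounds the projections of geodesics that do not penetrate a coset. -/
def IsPenetrationBound (X : Set G) (K : Subgroup G) (B : ℕ) : Prop :=
  ∀ (c : G ⧸ K) (x y u v : G), u ∈ cosetProj X K c x → v ∈ cosetProj X K c y →
    (B : ℕ∞) < outsideNorm X K (u⁻¹ * v) → Penetrates (cayley X K) (cosetSet c) x y

theorem exists_isPenetrationBound (hK : IsHypEmbedded X K) : ∃ B, IsPenetrationBound X K B := by
  obtain ⟨hΓ, δ, hδ⟩ := hK.hyperbolic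
  refine ⟨32 * δ + 13, fun c x y u v hu hv h => ?_⟩
  rw [← edist_cosetOutside hu.1 hv.1] at h
  exact IsSlim.penetrates (Γ' := cosetOutside X K c) hδ hΓ (cosetSet_pairwise_adj c)
    (cosetOutside_le c) (fun _ _ => cosetOutside_adj_of_adj) hu hv h

/-- The trivial geodesic from `x` to `x` has no edge, so it penetrates nothing. -/
theorem IsPenetrationBound.outsideNorm_le {B : ℕ} (hB : IsPenetrationBound X K B)
    (hu : u ∈ cosetProj X K c x) (hv : v ∈ cosetProj X K c x) :
    outsideNorm X K (u⁻¹ * v) ≤ B := by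
  by_contra h
  obtain ⟨i, hi, -⟩ := hB c x x u v hu hv (not_le.1 h) SimpleGraph.Walk.nil (by simp [IsGeodesic])
  simp at hi

/-- A coset is a clique, so distinct entry and exit points of a geodesic are consecutive vertices.
-/
theorem mem_cosetProj_of_mem_geodPairs (hΓ : (cayley X K).Connected) {t : K × K}
    (ht : t ∈ geodPairs X K x y c) (hne : t.1 ≠ t.2) :
    c.out * (t.1 : G) ∈ cosetProj X K c x ∧ c.out * (t.2 : G) ∈ cosetProj X K c y := by
  obtain ⟨p, hp, h1, h2, ⟨i, hi, ei, hi'⟩, j, hj, ej, -⟩ := ht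
  have hij : i ≤ j := by
    by_contra h
    exact hi' j (not_le.1 h) (ej ▸ h2)
  have hd := hp.dist_getVert hΓ hij hj
  have h3 := dist_le_one_of_mem (cosetSet_pairwise_adj (X := X) c) h1 h2
  rw [ei, ej] at hd
  have hij' : i ≠ j := by
    rintro rfl
    apply hne
    rw [ei] at ej
    exact Subtype.ext (mul_left_cancel ej)
  obtain rfl : j = i + 1 := by omega
  have := hp.mem_proj hΓ (cosetSet_pairwise_adj c) (i := i) (by omega) (by rwa [ei]) (by rwa [ej])
  rwa [ei, ej] at this

/-- The entry and exit points vary independently, which turns the average over pairs into an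
iterated average. -/
theorem mem_geodPairs_iff (hΓ : (cayley X K).Connected)
    (h : Penetrates (cayley X K) (cosetSet c) x y) {t : K × K} :
    t ∈ geodPairs X K x y c ↔
      c.out * (t.1 : G) ∈ cosetProj X K c x ∧ c.out * (t.2 : G) ∈ cosetProj X K c y := by
  constructor
  · intro ht
    refine mem_cosetProj_of_mem_geodPairs hΓ ht ?_
    intro e
    obtain ⟨p, hp, -, -, ⟨i, hi, ei, hi'⟩, j, hj, ej, hj'⟩ := ht
    obtain ⟨k, hk, h1, h2⟩ := h p hp
    have hik : i ≤ k := not_lt.1 fun hlt => hi' k hlt h1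
    have hkj : k + 1 ≤ j := not_lt.1 fun hlt => hj' (k + 1) hlt hk h2
    have := hp.dist_getVert hΓ (i := i) (j := j) (by omega) hj
    rw [ei, ej, e, SimpleGraph.dist_self] at this
    omega
  · rintro ⟨hu, hv⟩
    have hd := h.dist_eq hΓ (cosetSet_pairwise_adj c) hu hv
    obtain ⟨p, hp, e1, e2⟩ := exists_isGeodesic_through hΓ
      (h.adj hΓ (cosetSet_pairwise_adj c) hu hv) hd
    have hl : p.length = _ := hp
    refine ⟨p, hp, hu.1, hv.1, ⟨_, by omega, e1, fun j hj hm => ?_⟩,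
      ⟨_, by omega, e2, fun j hj hj' hm => ?_⟩⟩
    · have := hu.2 _ hm
      rw [hp.dist_left hΓ (by omega)] at this
      omega
    · have h1 := hv.2 _ hm
      rw [SimpleGraph.dist_comm, SimpleGraph.dist_comm (u := y), hp.dist_right hΓ hj'] at h1
      omega

/-- `B < C` is used twice: `C > 0` rules out equal entry and exit points, and a relative distance of
at least `C` forces penetration. -/
theorem mem_sepCosets_iff (hΓ : (cayley X K).Connected) {B : ℕ} (hB : IsPenetrationBound X K B)
    (hC : B < C) : c ∈ sepCosets X K C x y ↔
      ∃ u ∈ cosetProj X K c x, ∃ v ∈ cosetProj X K c y, (C : ℕ∞) ≤ outsideNorm X K (u⁻¹ * v) := by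
  constructor
  · rintro ⟨t, ht, h⟩
    have hne : t.1 ≠ t.2 := by
      intro e
      rw [e, relDist, SimpleGraph.edist_self] at h
      have : C ≤ 0 := by exact_mod_cast h
      omega
    obtain ⟨h1, h2⟩ := mem_cosetProj_of_mem_geodPairs hΓ ht hne
    refine ⟨_, h1, _, h2, ?_⟩
    rw [relDist_eq_outsideNorm] at h
    simpa [mul_assoc] using h
  · rintro ⟨u, hu, v, hv, h⟩
    have hp := hB c x y u v hu hv (lt_of_lt_of_le (by exact_mod_cast hC) h)
    refine ⟨(⟨_, mem_cosetSet_iff.1 hu.1⟩, ⟨_, mem_cosetSet_iff.1 hv.1⟩),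
      (mem_geodPairs_iff hΓ hp).2 (by simpa using ⟨hu, hv⟩), ?_⟩
    rw [relDist_eq_outsideNorm]
    simpa [mul_assoc] using h

theorem penetrates_of_mem_sepCosets (hΓ : (cayley X K).Connected) {B : ℕ}
    (hB : IsPenetrationBound X K B) (hC : B < C) (h : c ∈ sepCosets X K C x y) :
    Penetrates (cayley X K) (cosetSet c) x y := by
  obtain ⟨u, hu, v, hv, h⟩ := (mem_sepCosets_iff hΓ hB hC).1 h
  exact hB c x y u v hu hv (lt_of_lt_of_le (by exact_mod_cast hC) h)

theorem finite_sepCosets (hΓ : (cayley X K).Connected) {B : ℕ}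
    (hB : IsPenetrationBound X K B) (hC : B < C) (x y : G) : (sepCosets X K C x y).Finite :=
  (finite_setOf_penetrates (A := fun c : G ⧸ K => cosetSet c) hΓ
    (fun _ _ _ h h' => Eq.trans (Eq.symm h) h') x y).subset
    fun _ => penetrates_of_mem_sepCosets hΓ hB hC

/-- A projection lies in a translate of the relative `B`-ball of `K`, finite by local finiteness;
its cardinality serves as `Q` for all cosets and points. -/
theorem exists_cosetProj_finset (hK : IsHypEmbedded X K) {B : ℕ}
    (hB : IsPenetrationBound X K B) : ∃ (Q : ℕ) (P : G ⧸ K → G → Finset G),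
      (∀ c x u, u ∈ P c x ↔ u ∈ cosetProj X K c x) ∧ (∀ c x, (P c x).Nonempty) ∧
        ∀ c x, (P c x).card ≤ Q := by
  classical
  have hfin := finite_outsideNorm_le hK B
  have h : ∀ (c : G ⧸ K) (x : G), ∃ s : Finset G, (∀ u, u ∈ s ↔ u ∈ cosetProj X K c x) ∧
      s.Nonempty ∧ s.card ≤ hfin.toFinset.card := by
    intro c x
    obtain ⟨u₀, hu₀⟩ := proj_nonempty (cayley X K) (cosetSet_nonempty c) x
    have hsub : cosetProj X K c x ⊆ (hfin.toFinset.image (u₀ * ·) : Finset G) := by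
      intro u hu
      rw [Finset.coe_image, Set.Finite.coe_toFinset]
      exact ⟨u₀⁻¹ * u, ⟨inv_mul_mem_of_mem_cosetSet hu₀.1 hu.1, hB.outsideNorm_le hu₀ hu⟩,
        mul_inv_cancel_left _ _⟩
    have hf := (Finset.finite_toSet _).subset hsub
    refine ⟨hf.toFinset, fun u => hf.mem_toFinset, ⟨u₀, hf.mem_toFinset.2 hu₀⟩, ?_⟩
    refine le_trans (Finset.card_le_card fun u hu => ?_)
      (Finset.card_image_le (s := hfin.toFinset) (f := (u₀ * ·)))
    exact_mod_cast hsub (hf.mem_toFinset.1 hu)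
  choose P h1 h2 h3 using h
  exact ⟨_, P, h1, h2, h3⟩

end Cosets

/-! ### Averages over pairs of projections. -/

section Averages

open scoped BigOperators

variable {G : Type*} [Group G] {X : Set G} {K : Subgroup G} {C : ℕ} {h : G → ℝ}
  {P Q R : Finset G}

open Classical in
/-- The contribution of a coset to the extended bicombing, in terms of the projections `P`, `Q` of
the two ends to this coset. -/
noncomputable def cosetTerm (X : Set G) (K : Subgroup G) (C : ℕ) (h : G → ℝ) (P Q : Finset G) : ℝ :=
  if ∃ u ∈ P, ∃ v ∈ Q, (C : ℕ∞) ≤ outsideNorm X K (u⁻¹ * v) then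
    𝔼 u ∈ P, 𝔼 v ∈ Q, h (u⁻¹ * v) else 0

theorem cosetTerm_eq_zero
    (hPQ : ¬ ∃ u ∈ P, ∃ v ∈ Q, (C : ℕ∞) ≤ outsideNorm X K (u⁻¹ * v)) :
    cosetTerm X K C h P Q = 0 :=
  if_neg hPQ

theorem cosetTerm_swap (hK : ∀ u ∈ P, ∀ v ∈ Q, u⁻¹ * v ∈ K) (hh : ∀ g ∈ K, h g⁻¹ = - h g) :
    cosetTerm X K C h Q P = - cosetTerm X K C h P Q := by
  have h1 : (∃ u ∈ Q, ∃ v ∈ P, (C : ℕ∞) ≤ outsideNorm X K (u⁻¹ * v)) ↔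
      ∃ u ∈ P, ∃ v ∈ Q, (C : ℕ∞) ≤ outsideNorm X K (u⁻¹ * v) := by
    constructor
    · rintro ⟨u, hu, v, hv, H⟩
      refine ⟨v, hv, u, hu, ?_⟩
      rwa [← outsideNorm_inv (hK v hv u hu), mul_inv_rev, inv_inv]
    · rintro ⟨u, hu, v, hv, H⟩
      refine ⟨v, hv, u, hu, ?_⟩
      rwa [← outsideNorm_inv (hK u hu v hv), mul_inv_rev, inv_inv] at H
  by_cases hc : ∃ u ∈ P, ∃ v ∈ Q, (C : ℕ∞) ≤ outsideNorm X K (u⁻¹ * v)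
  · rw [cosetTerm, cosetTerm, if_pos hc, if_pos (h1.2 hc), Finset.expect_comm,
      ← Finset.expect_neg_distrib]
    refine Finset.expect_congr rfl fun u hu => ?_
    rw [← Finset.expect_neg_distrib]
    refine Finset.expect_congr rfl fun v hv => ?_
    rw [← hh _ (hK u hu v hv), mul_inv_rev, inv_inv]
  · rw [cosetTerm_eq_zero hc, cosetTerm_eq_zero (mt h1.1 hc), neg_zero]

/-- When the cutoff discards the term, all distances are below `C` and the average is zero anyway.
-/
theorem cosetTerm_eq_expect (hPQ : ∀ u ∈ P, ∀ v ∈ Q, outsideNorm X K (u⁻¹ * v) ≤ C →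
    h (u⁻¹ * v) = 0) : cosetTerm X K C h P Q = 𝔼 u ∈ P, 𝔼 v ∈ Q, h (u⁻¹ * v) := by
  by_cases hc : ∃ u ∈ P, ∃ v ∈ Q, (C : ℕ∞) ≤ outsideNorm X K (u⁻¹ * v)
  · rw [cosetTerm, if_pos hc]
  · rw [cosetTerm_eq_zero hc]
    push Not at hc
    exact (Finset.expect_eq_zero fun u hu => Finset.expect_eq_zero fun v hv =>
      hPQ u hu v hv (hc u hu v hv).le).symm

theorem expect_expect_add (hP : P.Nonempty) (hQ : Q.Nonempty) (hR : R.Nonempty)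
    (hh : ∀ u ∈ P, ∀ v ∈ Q, ∀ w ∈ R, h (u⁻¹ * w) = h (u⁻¹ * v) + h (v⁻¹ * w)) :
    𝔼 u ∈ P, 𝔼 w ∈ R, h (u⁻¹ * w) =
      𝔼 u ∈ P, 𝔼 v ∈ Q, h (u⁻¹ * v) + 𝔼 v ∈ Q, 𝔼 w ∈ R, h (v⁻¹ * w) := by
  calc 𝔼 u ∈ P, 𝔼 w ∈ R, h (u⁻¹ * w)
      = 𝔼 u ∈ P, 𝔼 v ∈ Q, 𝔼 w ∈ R, h (u⁻¹ * w) := by simp only [Finset.expect_const hQ]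
    _ = 𝔼 u ∈ P, 𝔼 v ∈ Q, 𝔼 w ∈ R, (h (u⁻¹ * v) + h (v⁻¹ * w)) :=
        Finset.expect_congr rfl fun u hu => Finset.expect_congr rfl fun v hv =>
          Finset.expect_congr rfl fun w hw => hh u hu v hv w hw
    _ = _ := by
        simp only [Finset.expect_add_distrib, Finset.expect_const hP, Finset.expect_const hR]

theorem cosetTerm_mul_left {P' Q' : Finset G} (g : G) (hP : ∀ u, g * u ∈ P' ↔ u ∈ P)
    (hQ : ∀ u, g * u ∈ Q' ↔ u ∈ Q) : cosetTerm X K C h P' Q' = cosetTerm X K C h P Q := by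
  classical
  have himage : ∀ {S S' : Finset G}, (∀ u, g * u ∈ S' ↔ u ∈ S) → S' = S.image (g * ·) := by
    intro S S' hS
    ext u
    rw [← mul_inv_cancel_left g u, hS]
    simp
  have hexpect : ∀ (S : Finset G) (f : G → ℝ), 𝔼 u ∈ S.image (g * ·), f u = 𝔼 u ∈ S, f (g * u) :=
    fun S f => Finset.expect_image (mul_right_injective g).injOn
  rw [himage hP, himage hQ]
  simp only [cosetTerm, Finset.mem_image, exists_exists_and_eq_and, hexpect]
  simp [mul_assoc]

end Averages

/-! ### The extended bicombing on triangles. -/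

section Extension

open scoped BigOperators

variable {G : Type*} [Group G] {X : Set G} {K : Subgroup G} {B C : ℕ} {P : G ⧸ K → G → Finset G}
  {H : K → ℝ} {x y z : G} {c : G ⧸ K}

/-- The extension by zero of a function on a subgroup. -/
noncomputable def extendZero (H : K → ℝ) : G → ℝ := Function.extend Subtype.val H 0

theorem extendZero_coe (H : K → ℝ) (k : K) : extendZero H k = H k :=
  Subtype.val_injective.extend_apply _ _ _

theorem finite_sepPairs (hΓ : (cayley X K).Connected) (hB : IsPenetrationBound X K B) (hC : B < C)
    (hP : ∀ c x u, u ∈ P c x ↔ u ∈ cosetProj X K c x) (x y : G) (c : G ⧸ K) :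
    (sepPairs X K C x y c).Finite := by
  refine Set.Finite.of_injOn (f := fun t : K × K => (c.out * (t.1 : G), c.out * (t.2 : G)))
    (t := (P c x ×ˢ P c y : Finset (G × G))) ?_ ?_ (Finset.finite_toSet _)
  · rintro t ⟨h1, h2⟩
    rw [mem_geodPairs_iff hΓ (penetrates_of_mem_sepCosets hΓ hB hC h1)] at h2
    simpa [hP] using h2
  · rintro t - t' - h
    simpa [Prod.ext_iff] using h

theorem sepCosets_term_eq (hΓ : (cayley X K).Connected) (hB : IsPenetrationBound X K B)
    (hC : B < C) (hP : ∀ c x u, u ∈ P c x ↔ u ∈ cosetProj X K c x)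
    (hc : c ∈ sepCosets X K C x y) :
    (1 / ((sepPairs X K C x y c).ncard : ℝ)) * ∑ᶠ t ∈ sepPairs X K C x y c, bicombing H t.1 t.2 =
      𝔼 u ∈ P c x, 𝔼 v ∈ P c y, extendZero H (u⁻¹ * v) := by
  obtain ⟨T, hT⟩ := (finite_sepPairs hΓ hB hC hP x y c).exists_finset_coe
  have hmem : ∀ t : K × K, t ∈ T ↔ c.out * (t.1 : G) ∈ P c x ∧ c.out * (t.2 : G) ∈ P c y := by
    intro t
    rw [← Finset.mem_coe, hT, hP, hP,
      ← mem_geodPairs_iff hΓ (penetrates_of_mem_sepCosets hΓ hB hC hc)]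
    exact and_iff_right hc
  rw [← hT, Set.ncard_coe_finset, finsum_mem_coe_finset, ← Finset.expect_product', mul_comm,
    mul_one_div, ← Finset.expect_eq_sum_div_card]
  refine Finset.expect_nbij (fun t => (c.out * (t.1 : G), c.out * (t.2 : G))) ?_ ?_ ?_ ?_
  · intro t ht
    exact Finset.mem_product.2 ((hmem t).1 ht)
  · intro t ht
    rw [show (c.out * (t.1 : G))⁻¹ * (c.out * (t.2 : G)) = ((t.1⁻¹ * t.2 : K) : G) by
      push_cast; group, extendZero_coe, bicombing]
  · rintro t - t' - h
    simpa [Prod.ext_iff] using h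
  · rintro ⟨u, v⟩ huv
    obtain ⟨hu, hv⟩ := Finset.mem_product.1 (Finset.mem_coe.1 huv)
    have hu' := ((hP _ _ _).1 hu).1
    have hv' := ((hP _ _ _).1 hv).1
    refine ⟨(⟨_, mem_cosetSet_iff.1 hu'⟩, ⟨_, mem_cosetSet_iff.1 hv'⟩), ?_, by simp⟩
    rw [Finset.mem_coe, hmem]
    simpa using ⟨hu, hv⟩

theorem mem_sepCosets_iff_finset (hΓ : (cayley X K).Connected) (hB : IsPenetrationBound X K B)
    (hC : B < C) (hP : ∀ c x u, u ∈ P c x ↔ u ∈ cosetProj X K c x) : c ∈ sepCosets X K C x y ↔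
      ∃ u ∈ P c x, ∃ v ∈ P c y, (C : ℕ∞) ≤ outsideNorm X K (u⁻¹ * v) := by
  simp only [mem_sepCosets_iff hΓ hB hC, hP]

theorem extBicombing_eq_finsum (hΓ : (cayley X K).Connected) (hB : IsPenetrationBound X K B)
    (hC : B < C) (hP : ∀ c x u, u ∈ P c x ↔ u ∈ cosetProj X K c x) (H : K → ℝ) (x y : G) :
    extBicombing X K C H x y =
      ∑ᶠ c : G ⧸ K, cosetTerm X K C (extendZero H) (P c x) (P c y) := by
  classical
  refine finsum_congr fun c => ?_
  by_cases hc : c ∈ sepCosets X K C x y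
  · rw [finsum_eq_if, if_pos hc, sepCosets_term_eq hΓ hB hC hP hc, cosetTerm,
      if_pos ((mem_sepCosets_iff_finset hΓ hB hC hP).1 hc)]
  · rw [finsum_eq_if, if_neg hc,
      cosetTerm_eq_zero (mt (mem_sepCosets_iff_finset hΓ hB hC hP).2 hc)]

/-- The chosen representatives are not equivariant, but the formula by projections involves only the
products `u⁻¹ * v`. -/
theorem extBicombing_mul_left (hΓ : (cayley X K).Connected) (hB : IsPenetrationBound X K B)
    (hC : B < C) (hP : ∀ c x u, u ∈ P c x ↔ u ∈ cosetProj X K c x) (H : K → ℝ) (g x y : G) :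
    extBicombing X K C H (g * x) (g * y) = extBicombing X K C H x y := by
  rw [extBicombing_eq_finsum hΓ hB hC hP, extBicombing_eq_finsum hΓ hB hC hP,
    ← finsum_comp_equiv (MulAction.toPerm g)]
  refine finsum_congr fun c => cosetTerm_mul_left g (fun u => ?_) (fun u => ?_)
  · rw [MulAction.toPerm_apply, hP, hP, mul_mem_cosetProj_smul]
  · rw [MulAction.toPerm_apply, hP, hP, mul_mem_cosetProj_smul]

theorem extension_mul_sub (hΓ : (cayley X K).Connected) (hB : IsPenetrationBound X K B)
    (hC : B < C) (hP : ∀ c x u, u ∈ P c x ↔ u ∈ cosetProj X K c x) (H : K → ℝ) (x y : G) :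
    extension X K C H (x * y) - extension X K C H x - extension X K C H y =
      extBicombing X K C H 1 (x * y) - extBicombing X K C H 1 x -
        extBicombing X K C H x (x * y) := by
  rw [extension, extension, extension, ← extBicombing_mul_left hΓ hB hC hP H x 1 y, mul_one]

/-- The cosets penetrated by the geodesics from `x` to `y` and by those from `x` to `z` to which
`y` and `z` have distinct projections. -/
def branchCosets (X : Set G) (K : Subgroup G) (x y z : G) : Set (G ⧸ K) :=
  {c | Penetrates (cayley X K) (cosetSet c) x y ∧ Penetrates (cayley X K) (cosetSet c) x z ∧
    cosetProj X K c y ≠ cosetProj X K c z}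

theorem branchCosets_subsingleton (hΓ : (cayley X K).Connected) (x y z : G) :
    (branchCosets X K x y z).Subsingleton :=
  subsingleton_setOf_proj_ne (A := fun c : G ⧸ K => cosetSet c) hΓ cosetSet_pairwise_adj
    cosetSet_nonempty (fun _ _ _ h h' => Eq.trans (Eq.symm h) h') x y z

/-- Otherwise the relative distance from `u` to `w` through a projection of `y` is at most `2 * B`,
less than `C`. -/
theorem penetrates_or_penetrates (hB : IsPenetrationBound X K B) (hC : 2 * B + 2 ≤ C) {u w : G}
    (hu : u ∈ cosetProj X K c x) (hw : w ∈ cosetProj X K c z)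
    (h : (C : ℕ∞) ≤ outsideNorm X K (u⁻¹ * w)) (y : G) :
    Penetrates (cayley X K) (cosetSet c) x y ∨ Penetrates (cayley X K) (cosetSet c) y z := by
  obtain ⟨v, hv⟩ := proj_nonempty (cayley X K) (cosetSet_nonempty c) y
  by_contra hc
  rw [not_or] at hc
  have h1 := not_lt.1 (mt (hB c x y u v hu hv) hc.1)
  have h2 := not_lt.1 (mt (hB c y z v w hv hw) hc.2)
  have h3 : (C : ℕ∞) ≤ (B + B : ℕ) := by
    push_cast
    exact h.trans ((outsideNorm_triangle hu.1 hv.1 hw.1).trans (add_le_add h1 h2))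
  have : C ≤ B + B := by exact_mod_cast h3
  omega

theorem mem_branchCosets (hB : IsPenetrationBound X K B) (hC : 2 * B + 2 ≤ C) {u w : G}
    (hu : u ∈ cosetProj X K c x) (hw : w ∈ cosetProj X K c z)
    (h : (C : ℕ∞) ≤ outsideNorm X K (u⁻¹ * w)) (y : G)
    (hxy : cosetProj X K c x ≠ cosetProj X K c y) (hyz : cosetProj X K c y ≠ cosetProj X K c z) :
    c ∈ branchCosets X K x y z ∪ branchCosets X K z x y := by
  have hxz := hB c x z u w hu hw (lt_of_lt_of_le (by exact_mod_cast (by omega)) h)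
  rcases penetrates_or_penetrates hB hC hu hw h y with h1 | h1
  · exact Or.inl ⟨h1, hxz, hyz⟩
  · exact Or.inr ⟨hxz.symm, h1.symm, hxy⟩

theorem branchCosets_swap (X : Set G) (K : Subgroup G) (x y z : G) :
    branchCosets X K x y z = branchCosets X K x z y := by
  ext c
  simp only [branchCosets, Set.mem_ofPred_eq, ne_eq, eq_comm]
  tauto

/-- Away from the branching cosets of a triangle the contributions of its sides cancel. -/
theorem cosetTerm_add_of_notMem (hB : IsPenetrationBound X K B) (hC : 2 * B + 2 ≤ C)
    (hP : ∀ c x u, u ∈ P c x ↔ u ∈ cosetProj X K c x) {h : G → ℝ}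
    (hh : ∀ g ∈ K, h g⁻¹ = - h g)
    (hc : c ∉ branchCosets X K x y z ∪ branchCosets X K y x z ∪ branchCosets X K z x y) :
    cosetTerm X K C h (P c x) (P c z) =
      cosetTerm X K C h (P c x) (P c y) + cosetTerm X K C h (P c y) (P c z) := by
  have hself : ∀ x, cosetTerm X K C h (P c x) (P c x) = 0 := by
    refine fun x => cosetTerm_eq_zero ?_
    rintro ⟨u, hu, v, hv, huv⟩
    rw [hP] at hu hv
    have : (C : ℕ∞) ≤ B := huv.trans (hB.outsideNorm_le hu hv)
    have : C ≤ B := by exact_mod_cast this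
    omega
  have hcongr : ∀ x y, cosetProj X K c x = cosetProj X K c y → P c x = P c y := by
    intro x y h
    ext u
    rw [hP, hP, h]
  by_cases hxy : cosetProj X K c x = cosetProj X K c y
  · rw [hcongr x y hxy, hself, zero_add]
  by_cases hyz : cosetProj X K c y = cosetProj X K c z
  · rw [hcongr y z hyz, hself, add_zero]
  by_cases hxz : cosetProj X K c x = cosetProj X K c z
  · rw [hcongr x z hxz, hself, cosetTerm_swap (P := P c z) (Q := P c y) _ hh, add_neg_cancel]
    intro u hu v hv
    rw [hP] at hu hv
    exact inv_mul_mem_of_mem_cosetSet hu.1 hv.1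
  -- All three projections differ, so a side passing the cutoff would make `c` a branching coset;
  -- hence every term is zero.
  · simp only [Set.mem_union, not_or] at hc
    rw [cosetTerm_eq_zero, cosetTerm_eq_zero, cosetTerm_eq_zero, add_zero]
    · rintro ⟨u, hu, v, hv, huv⟩
      rw [hP] at hu hv
      rcases mem_branchCosets hB hC hu hv huv x (Ne.symm hxy) hxz with h1 | h1
      · exact hc.1.2 h1
      · exact hc.2 (branchCosets_swap X K z x y ▸ h1)
    · rintro ⟨u, hu, v, hv, huv⟩
      rw [hP] at hu hv
      rcases mem_branchCosets hB hC hu hv huv z hxz (Ne.symm hyz) with h1 | h1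
      · exact hc.1.1 (branchCosets_swap X K x y z ▸ h1)
      · exact hc.1.2 h1
    · rintro ⟨u, hu, v, hv, huv⟩
      rw [hP] at hu hv
      rcases mem_branchCosets hB hC hu hv huv y hxy hyz with h1 | h1
      · exact hc.1.1 h1
      · exact hc.2 h1

theorem extBicombing_sub_eq_zero (hΓ : (cayley X K).Connected) (hB : IsPenetrationBound X K B)
    (hC : 2 * B + 2 ≤ C) (hP : ∀ c x u, u ∈ P c x ↔ u ∈ cosetProj X K c x) {H : K → ℝ} {x y z : G}
    (h : ∀ c, cosetTerm X K C (extendZero H) (P c x) (P c z) =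
      cosetTerm X K C (extendZero H) (P c x) (P c y) +
        cosetTerm X K C (extendZero H) (P c y) (P c z)) :
    extBicombing X K C H x z - extBicombing X K C H x y - extBicombing X K C H y z = 0 := by
  have hC' : B < C := by omega
  have hfin : ∀ x y, (Function.support fun c : G ⧸ K =>
      cosetTerm X K C (extendZero H) (P c x) (P c y)).Finite := by
    refine fun x y => (finite_sepCosets hΓ hB hC' x y).subset fun c hc => ?_
    by_contra hc'
    exact hc (cosetTerm_eq_zero (mt (mem_sepCosets_iff_finset hΓ hB hC' hP).2 hc'))
  simp only [extBicombing_eq_finsum hΓ hB hC' hP, h]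
  rw [finsum_add_distrib (hfin x y) (hfin y z)]
  ring

theorem encard_biUnion_le_mul {ι κ : Type*} (s : Finset ι) (f : ι → Set κ) {m n : ℕ}
    (hs : s.card ≤ m) (hf : ∀ i ∈ s, (f i).encard ≤ n) :
    (⋃ i ∈ s, f i).encard ≤ (m * n : ℕ) := by
  calc _ ≤ ∑ i ∈ s, (f i).encard := s.set_encard_biUnion_le f
    _ ≤ s.card • (n : ℕ∞) := Finset.sum_le_card_nsmul _ _ _ hf
    _ = (s.card * n : ℕ) := by simp
    _ ≤ (m * n : ℕ) := by exact_mod_cast Nat.mul_le_mul_right n hs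

/-- If the functions `H i` on `K` are odd, if for any `k`, `l` all but at most `m` of them are
additive on `(k, l)`, and if almost all of them vanish at each point, then for any `x`, `y` all but
boundedly many of their extensions to `G` are additive on `(x, y)`. -/
theorem exists_encard_extension_mul_ne_le (hK : IsHypEmbedded X K)
    (hB : IsPenetrationBound X K B) (hC : 2 * B + 2 ≤ C) (H : ℕ → K → ℝ)
    (hinv : ∀ i k, H i k⁻¹ = - H i k) {m : ℕ}
    (hmul : ∀ k l, {i | H i (k * l) ≠ H i k + H i l}.encard ≤ m)
    (hzero : ∀ s : Set K, s.Finite → ∃ i₀, ∀ i, i₀ ≤ i → ∀ k ∈ s, H i k = 0) :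
    ∃ M : ℕ, 0 < M ∧ ∀ x y : G, {i : ℕ | ¬ (extension X K C (H i) (x * y) -
      extension X K C (H i) x - extension X K C (H i) y = 0)}.encard ≤ (M : ℕ∞) := by
  classical
  have hΓ := hK.hyperbolic.1
  obtain ⟨Q, P, hP, hne, hQ⟩ := exists_cosetProj_finset hK hB
  -- From `i₀` on, the functions vanish on the relative ball of radius `C`, which makes the cutoff
  -- invisible.
  obtain ⟨i₀, hi₀⟩ := hzero _ (hK.locally_finite 1 C)
  have hodd : ∀ i, ∀ g ∈ K, extendZero (H i) g⁻¹ = - extendZero (H i) g := by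
    intro i g hg
    have h1 := extendZero_coe (H i) ⟨g, hg⟩⁻¹
    have h2 := extendZero_coe (H i) ⟨g, hg⟩
    simp only [InvMemClass.coe_inv] at h1 h2
    rw [h1, h2, hinv]
  have hsmall : ∀ i, i₀ ≤ i → ∀ g ∈ K, outsideNorm X K g ≤ C → extendZero (H i) g = 0 := by
    intro i hi g hg hgC
    rw [extendZero_coe (H i) ⟨g, hg⟩]
    refine hi₀ i hi _ ?_
    rw [Set.mem_ofPred_eq, relDist_eq_outsideNorm]
    simpa using hgC
  have hadd : ∀ k ∈ K, ∀ l ∈ K, {i | extendZero (H i) (k * l) ≠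
      extendZero (H i) k + extendZero (H i) l}.encard ≤ m := by
    intro k hk l hl
    have h1 := fun i => extendZero_coe (H i) (⟨k, hk⟩ * ⟨l, hl⟩)
    have h2 := fun i => extendZero_coe (H i) ⟨k, hk⟩
    have h3 := fun i => extendZero_coe (H i) ⟨l, hl⟩
    simp only [Subgroup.coe_mul] at h1 h2 h3
    simp only [h1, h2, h3]
    exact hmul _ _
  -- Three branching cosets, at most `Q ^ 3` triples of projection points in each, `m` bad indices
  -- per triple; the final 1 only ensures positivity.
  refine ⟨i₀ + 3 * (Q * (Q * Q) * m) + 1, by omega, fun x y => ?_⟩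
  set z := x * y with hz
  have hbr : (branchCosets X K 1 x z ∪ branchCosets X K x 1 z ∪ branchCosets X K z 1 x).encard
      ≤ 3 := by
    have h1 := fun x y z : G => Set.encard_le_one_iff_subsingleton.2
      (branchCosets_subsingleton hΓ x y z)
    calc _ ≤ _ := Set.encard_union_le _ _
      _ ≤ _ := add_le_add (Set.encard_union_le _ _) le_rfl
      _ ≤ 1 + 1 + 1 := add_le_add (add_le_add (h1 _ _ _) (h1 _ _ _)) (h1 _ _ _)
      _ = 3 := by norm_num
  obtain ⟨D, hD⟩ := (Set.finite_of_encard_le_coe (k := 3) hbr).exists_finset_coe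
  rw [← hD, Set.encard_coe_eq_coe_finsetCard] at hbr
  have hDcard : D.card ≤ 3 := by exact_mod_cast hbr
  set T : G ⧸ K → Finset (G × G × G) := fun c => P c 1 ×ˢ P c x ×ˢ P c z with hT
  set E : G × G × G → Set ℕ := fun t => {i | extendZero (H i) ((t.1⁻¹ * t.2.1) * (t.2.1⁻¹ * t.2.2)) ≠
    extendZero (H i) (t.1⁻¹ * t.2.1) + extendZero (H i) (t.2.1⁻¹ * t.2.2)} with hE
  have hKmem : ∀ {c x y u v}, u ∈ P c x → v ∈ P c y → u⁻¹ * v ∈ K := by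
    intro c x y u v hu hv
    rw [hP] at hu hv
    exact inv_mul_mem_of_mem_cosetSet hu.1 hv.1
  have hTE : (⋃ c ∈ D, ⋃ t ∈ T c, E t).encard ≤ (3 * (Q * (Q * Q) * m) : ℕ) := by
    refine encard_biUnion_le_mul _ _ hDcard fun c _ => encard_biUnion_le_mul _ _ ?_ ?_
    · rw [hT, Finset.card_product, Finset.card_product]
      exact Nat.mul_le_mul (hQ _ _) (Nat.mul_le_mul (hQ _ _) (hQ _ _))
    · rintro ⟨u, v, w⟩ ht
      simp only [hT, Finset.mem_product] at ht
      exact hadd _ (hKmem ht.1 ht.2.1) _ (hKmem ht.2.1 ht.2.2)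
  have hsub : {i : ℕ | ¬ (extension X K C (H i) z - extension X K C (H i) x -
      extension X K C (H i) y = 0)} ⊆ (Finset.range i₀ : Set ℕ) ∪ ⋃ c ∈ D, ⋃ t ∈ T c, E t := by
    intro i hi
    by_contra hc
    rw [Set.mem_union, not_or, Finset.mem_coe, Finset.mem_range, not_lt] at hc
    obtain ⟨hi', hc⟩ := hc
    apply hi
    rw [hz, extension_mul_sub hΓ hB (by omega) hP]
    refine extBicombing_sub_eq_zero hΓ hB hC hP fun c => ?_
    by_cases hcD : c ∈ D
    · have hex : ∀ x y, cosetTerm X K C (extendZero (H i)) (P c x) (P c y) =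
          𝔼 u ∈ P c x, 𝔼 v ∈ P c y, extendZero (H i) (u⁻¹ * v) := fun x y =>
        cosetTerm_eq_expect fun u hu v hv hle => hsmall i hi' _ (hKmem hu hv) hle
      rw [hex, hex, hex]
      refine expect_expect_add (hne _ _) (hne _ _) (hne _ _) fun u hu v hv w hw => ?_
      by_contra hcon
      apply hc
      simp only [Set.mem_iUnion]
      refine ⟨c, hcD, (u, v, w), by simp [hT, hu, hv, hz, hw], ?_⟩
      simpa [hE, mul_assoc] using hcon
    · refine cosetTerm_add_of_notMem hB hC hP (hodd i) ?_
      rw [← hD]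
      exact hcD
  calc _ ≤ _ := Set.encard_le_encard hsub
    _ ≤ _ := Set.encard_union_le _ _
    _ ≤ (i₀ : ℕ∞) + (3 * (Q * (Q * Q) * m) : ℕ) :=
        add_le_add (by rw [Set.encard_coe_eq_coe_finsetCard, Finset.card_range]) hTE
    _ ≤ _ := by exact_mod_cast Nat.le_succ _

end Extension

/-- If all but at most `M` functions of a family are additive on each pair, then all but at most
`M * (k - 1)` of them are additive on each `k`-tuple. -/
theorem encard_prod_sub_sum_ne_le {G : Type*} [Group G] {f : ℕ → G → ℝ} {M : ℕ}
    (h : ∀ x y, {i : ℕ | 1 ≤ i ∧ ¬ (f i (x * y) - f i x - f i y = 0)}.encard ≤ (M : ℕ∞)) (k : ℕ) :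
    ∀ s : Fin (k + 1) → G, {i : ℕ | 1 ≤ i ∧
      ¬ (f i (List.ofFn s).prod - ∑ j, f i (s j) = 0)}.encard ≤ ((M * k : ℕ) : ℕ∞) := by
  induction k with
  | zero => intro s; simp
  | succ k ih =>
    intro s
    -- Splitting off the first factor costs one pair `(s 0, p)`, that is, `M` further indices.
    set p := (List.ofFn fun j : Fin (k + 1) => s j.succ).prod with hp
    calc _ ≤ ({i : ℕ | 1 ≤ i ∧ ¬ (f i (s 0 * p) - f i (s 0) - f i p = 0)} ∪
          {i : ℕ | 1 ≤ i ∧ ¬ (f i p - ∑ j : Fin (k + 1), f i (s j.succ) = 0)}).encard := by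
          apply Set.encard_le_encard
          rintro i ⟨h1, h2⟩
          by_contra hc
          simp only [Set.mem_union, Set.mem_ofPred_eq, h1, true_and, not_or, not_not] at hc
          apply h2
          rw [List.ofFn_succ, List.prod_cons, Fin.sum_univ_succ, ← hp]
          linarith [hc.1, hc.2]
      _ ≤ _ := Set.encard_union_le _ _
      _ ≤ (M : ℕ∞) + (M * k : ℕ) := add_le_add (h _ _) (ih _)
      _ = _ := by push_cast; ring

end HullOsin

theorem proposition4p2 {G N α : Type*} [Group G] [Group N] [Finite N] [DecidableEq α]
    (K : Subgroup G) (X : Set G) (hK : HullOsin.IsHypEmbedded X K) :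
    ∃ C₀ : ℕ, ∀ C : ℕ, C₀ ≤ C →
      (∀ x y : G, (HullOsin.sepCosets X K C x y).Finite ∧
        ∀ c : G ⧸ K, (HullOsin.sepPairs X K C x y c).Finite) ∧
      ∀ (e : FreeGroup α × N ≃* K) (a b : α), a ≠ b →
      ∃ M : ℕ, 0 < M ∧
        (∀ x y : G, {i : ℕ | 1 ≤ i ∧
          ¬ (HullOsin.extension X K C (HullOsin.brooksOn e a b i) (x * y)
            - HullOsin.extension X K C (HullOsin.brooksOn e a b i) x
            - HullOsin.extension X K C (HullOsin.brooksOn e a b i) y = 0)}.encard ≤ (M : ℕ∞)) ∧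
        (∀ k : ℕ, 1 ≤ k → ∀ s : Fin k → G, {i : ℕ | 1 ≤ i ∧
          ¬ (HullOsin.extension X K C (HullOsin.brooksOn e a b i) (List.ofFn s).prod
            - ∑ j, HullOsin.extension X K C (HullOsin.brooksOn e a b i) (s j) = 0)}.encard
              ≤ ((M * (k - 1) : ℕ) : ℕ∞)) := by
  have hΓ := hK.hyperbolic.1
  obtain ⟨B, hB⟩ := HullOsin.exists_isPenetrationBound hK
  obtain ⟨Q, P, hP, -, -⟩ := HullOsin.exists_cosetProj_finset hK hB
  -- The bound `B` comes from hyperbolicity alone, so this threshold precedes the choice of `e`,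
  -- `a`, `b`.
  refine ⟨2 * B + 2, fun C hC => ⟨fun x y => ⟨HullOsin.finite_sepCosets hΓ hB (by omega) x y,
    HullOsin.finite_sepPairs hΓ hB (by omega) hP x y⟩, fun e a b hab => ?_⟩⟩
  obtain ⟨M, hM, h⟩ := HullOsin.exists_encard_extension_mul_ne_le hK hB hC
    (HullOsin.brooksOn e a b) (HullOsin.brooksOn_inv e a b) (m := 12)
    (HullOsin.encard_brooksOn_mul_ne_le e hab)
    (fun s hs => HullOsin.exists_brooksOn_eq_zero e a b hs)
  have h' : ∀ x y : G, {i : ℕ | 1 ≤ i ∧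
      ¬ (HullOsin.extension X K C (HullOsin.brooksOn e a b i) (x * y)
        - HullOsin.extension X K C (HullOsin.brooksOn e a b i) x
        - HullOsin.extension X K C (HullOsin.brooksOn e a b i) y = 0)}.encard ≤ (M : ℕ∞) :=
    fun x y => (Set.encard_le_encard fun i hi => hi.2).trans (h x y)
  refine ⟨M, hM, h', fun k hk => ?_⟩
  obtain ⟨k, rfl⟩ := Nat.exists_eq_add_of_le' hk
  exact HullOsin.encard_prod_sub_sum_ne_le h' k
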